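/- All graphs are finite and simple. First-order sentences about graphs are built from variables ranging over vertices, the relations $=$ and $\sim$ (adjacency), the Boolean connectives and the quantifiers $\forall,\exists$. The depth of a sentence is the maximum length of a chain of nested quantifiers; its alternation number is the maximum number of changes between $\exists$ and $\forall$ along a chain of nested quantifiers after all negations have been pushed down to the atomic formulas. A sentence defines a graph $G$ if it is true on $G$ and false on every graph not isomorphic to $G$. Let $D(G)$ be the smallest depth of a sentence defining $G$, and let $D_2(G)$ be the smallest depth of a sentence that defines $G$ and has alternation number at most $2$. Let $\mathcal G(n,\frac12)$ be the random graph on $n$ labelled vertices in which each edge is present independently with probability $\frac12$, and put $$L(n)=\log_2 n-2\log_2\ln n+\log_2\ln 2 .$$ Theorem. There are a strictly increasing sequence of natural numbers $n_0<n_1<n_2<\dots$, reals $\varepsilon_j\to0$ and integers $a_j\ge 0$ such that for $G\in\mathcal G(n_j,\frac12)$, each of the following holds with probability tending to $1$ as $j\to\infty$: 1. $D_2(G)\le L(n_j)+6+\varepsilon_j$; 2. $D(G)\ge L(n_j)+1-\varepsilon_j$; 3. $D(G)$ and $D_2(G)$ both belong to the set $\{a_j,a_j+1,a_j+2,a_j+3,a_j+4\}$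 of five consecutive integers. -/

import Mathlib

namespace FirstOrderComplexity

open FirstOrder

/-- Quantifier depth: the length of a longest chain of nested quantifiers. -/
def quantDepth {α : Type} : {n : ℕ} → Language.graph.BoundedFormula α n → ℕ
  | _, .falsum => 0
  | _, .equal _ _ => 0
  | _, .rel _ _ => 0
  | _, .imp φ ψ => max (quantDepth φ) (quantDepth ψ)
  | _, .all φ => quantDepth φ + 1

/-- The largest number of changes between `∀` and `∃` along a chain of nested quantifiers, once all
negations have been pushed down to the atomic formulas.

Mathlib builds formulas from `⊥`, `→` and `∀` (so `¬ φ` is `φ → ⊥` and `∃ x φ` is `¬ ∀ x ¬ φ`).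
The argument `pos` says whether the current subformula occurs positively (under an even number of
negations or left sides of implications); a `∀` is universal in the negation normal form if it
occurs positively, and existential if it occurs negatively. The argument `last` is the kind of the
closest enclosing quantifier, if there is one (`true` for universal, `false` for existential). -/
def altFrom {α : Type} :
    {n : ℕ} → Language.graph.BoundedFormula α n → (pos : Bool) → (last : Option Bool) → ℕ
  | _, .falsum, _, _ => 0
  | _, .equal _ _, _, _ => 0
  | _, .rel _ _, _, _ => 0
  | _, .imp φ ψ, pos, last => max (altFrom φ (!pos) last) (altFrom ψ pos last)
  | _, .all φ, pos, last => altFrom φ pos (some pos) + if last = some (!pos) then 1 else 0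

/-- The alternation number of a formula. -/
def alternationNumber {α : Type} {n : ℕ} (φ : Language.graph.BoundedFormula α n) : ℕ :=
  altFrom φ true none

/-- `G ⊨ A`. -/
def Satisfies {V : Type} (G : SimpleGraph V) (A : Language.graph.Sentence) : Prop :=
  @Language.Sentence.Realize Language.graph V G.structure A

/-- The sentence `A` defines `G`: it holds on `G`, and it fails on every (finite) graph that is not
isomorphic to `G`. -/
def Defines {V : Type} (A : Language.graph.Sentence) (G : SimpleGraph V) : Prop :=
  Satisfies G A ∧
    ∀ (W : Type) [Finite W] (H : SimpleGraph W), ¬ Nonempty (G ≃g H) → ¬ Satisfies H A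

/-- `D(G)`: the smallest quantifier depth of a sentence that defines `G`
(`⊤` if there were no such sentence). -/
noncomputable def defDepth {V : Type} (G : SimpleGraph V) : ℕ∞ :=
  ⨅ (A : Language.graph.Sentence) (_ : Defines A G), (quantDepth A : ℕ∞)

/-- `D_r(G)`: the smallest quantifier depth of a sentence that defines `G` and has alternation
number at most `r` (`⊤` if there were no such sentence). -/
noncomputable def defDepthAlt (r : ℕ) {V : Type} (G : SimpleGraph V) : ℕ∞ :=
  ⨅ (A : Language.graph.Sentence) (_ : Defines A G ∧ alternationNumber A ≤ r),
    (quantDepth A : ℕ∞)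

/-- The edge probability `1/2`. -/
noncomputable def half : unitInterval := ⟨1 / 2, by norm_num, by norm_num⟩

/-- The probability that `G ∈ G(n, 1/2)` has the property `P`. -/
noncomputable def prob (n : ℕ) (P : SimpleGraph (Fin n) → Prop) : ℝ :=
  (SimpleGraph.binomialRandom (Fin n) half).real {G | P G}

/-- `log₂ n - 2 log₂ ln n + log₂ ln 2`. -/
noncomputable def mainTerm (n : ℕ) : ℝ :=
  Real.logb 2 n - 2 * Real.logb 2 (Real.log n) + Real.logb 2 (Real.log 2)

end FirstOrderComplexity

/-!
Take `n = k² 2^(k-1)`, so that a `k`-tuple has about `k² / 2` common neighbours on average and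
`k - 2 ≤ L(n) ≤ k`.

*Lower bound.* With high probability every adjacency pattern over `k - 1` vertices is realised by a
further vertex. The Ehrenfeucht game of `k` rounds then does not distinguish the graph from a larger
one with the same extension property, so `D ≥ k + 1`.

*Upper bound.* Call a vertex pinned if, for the atomic type of some `k`-tuple, it is the only vertex
that is the unique common neighbour of a tuple of that type. A fixed vertex is pinned with high
probability: among the tuples with one entry in each of `k` disjoint blocks, some tuple has it as
its unique common neighbour by Chebyshev's inequality, and a first moment bound excludes another
tuple of the same type with a unique common neighbour. By Markov's inequality fewer than `2^(k-3)`
vertices fail to be pinned. The extension property separates any two vertices by at least `2^(k-3)`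
others, hence by a pinned one, so every vertex is determined by its adjacencies to the pinned
vertices; expressing this with two quantifier alternations gives `D₂ ≤ k + 4`.
-/

namespace FirstOrderComplexity

open scoped BigOperators
open FirstOrder Language

section Expressibility

variable {m d e u : ℕ}

theorem altFrom_bnot {α : Type} {n : ℕ} (φ : Language.graph.BoundedFormula α n) (pos : Bool)
    (last : Option Bool) : altFrom φ (!pos) (last.map not) = altFrom φ pos last := by
  induction φ generalizing pos last with
  | falsum | equal _ _ | rel _ _ => rfl
  | imp φ ψ ihφ ihψ => simp only [altFrom, ihφ, ihψ]
  | all φ ih =>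
    have hφ : altFrom φ (!pos) (some !pos) = altFrom φ pos (some pos) := ih pos (some pos)
    rw [altFrom, altFrom, hφ]
    cases last <;> simp

theorem altFrom_none_le {α : Type} {n : ℕ} (φ : Language.graph.BoundedFormula α n) (pos : Bool)
    (last : Option Bool) : altFrom φ pos none ≤ altFrom φ pos last := by
  induction φ generalizing pos with
  | falsum | equal _ _ | rel _ _ => exact le_rfl
  | imp φ ψ ihφ ihψ => exact max_le_max (ihφ _) (ihψ _)
  | all φ _ => simp [altFrom]

/-- A property of the `m`-tuples of vertices of a graph. -/
abbrev TupleProperty (m : ℕ) := ∀ W : Type, SimpleGraph W → (Fin m → W) → Prop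

/-- A property of the vertices of a graph. -/
abbrev VertexProperty := ∀ W : Type, SimpleGraph W → W → Prop

/-- `P` is expressed by a formula of depth at most `d` whose alternation number is at most `e` below
an existential quantifier and at most `u` below a universal one. Negation swaps `e` and `u`. -/
def Expressible (m d e u : ℕ) (P : TupleProperty m) : Prop :=
  ∃ φ : Language.graph.BoundedFormula Empty m, quantDepth φ ≤ d ∧
    altFrom φ true (some false) ≤ e ∧ altFrom φ true (some true) ≤ u ∧
    ∀ (W : Type) (H : SimpleGraph W) (v : Empty → W) (xs : Fin m → W),
      @BoundedFormula.Realize _ W H.structure _ _ φ v xs ↔ P W H xs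

namespace Expressible

variable {P Q : TupleProperty m}

theorem congr (h : Expressible m d e u P)
    (hPQ : ∀ (W : Type) (H : SimpleGraph W) (xs : Fin m → W), P W H xs ↔ Q W H xs) :
    Expressible m d e u Q := by
  obtain ⟨φ, hd, he, hu, hφ⟩ := h
  exact ⟨φ, hd, he, hu, fun W H v xs => (hφ W H v xs).trans (hPQ W H xs)⟩

theorem mono {d' e' u' : ℕ} (h : Expressible m d e u P) (hdd : d ≤ d') (hee : e ≤ e')
    (huu : u ≤ u') : Expressible m d' e' u' P := by
  obtain ⟨φ, hd, he, hu, hφ⟩ := h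
  exact ⟨φ, hd.trans hdd, he.trans hee, hu.trans huu, hφ⟩

theorem falsum : Expressible m d e u (fun _ _ _ => False) :=
  ⟨.falsum, Nat.zero_le _, Nat.zero_le _, Nat.zero_le _, fun _ _ _ _ => Iff.rfl⟩

theorem eq (i j : Fin m) : Expressible m d e u (fun _ _ xs => xs i = xs j) :=
  ⟨.equal (Term.var (Sum.inr i)) (Term.var (Sum.inr j)), Nat.zero_le _, Nat.zero_le _,
    Nat.zero_le _, fun _ _ _ _ => Iff.rfl⟩

theorem adj (i j : Fin m) : Expressible m d e u (fun _ H xs => H.Adj (xs i) (xs j)) :=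
  ⟨Language.adj.boundedFormula₂ (Term.var (Sum.inr i)) (Term.var (Sum.inr j)), Nat.zero_le _,
    Nat.zero_le _, Nat.zero_le _, fun _ _ _ _ => Iff.rfl⟩

theorem imp (hP : Expressible m d u e P) (hQ : Expressible m d e u Q) :
    Expressible m d e u (fun W H xs => P W H xs → Q W H xs) := by
  obtain ⟨φ, hφd, hφe, hφu, hφ⟩ := hP
  obtain ⟨ψ, hψd, hψe, hψu, hψ⟩ := hQ
  exact ⟨φ.imp ψ, max_le hφd hψd,
    max_le ((altFrom_bnot φ true (some true)).trans_le hφu) hψe,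
    max_le ((altFrom_bnot φ true (some false)).trans_le hφe) hψu,
    fun W H v xs => imp_congr (hφ W H v xs) (hψ W H v xs)⟩

theorem not (h : Expressible m d e u P) : Expressible m d u e (fun W H xs => ¬ P W H xs) :=
  h.imp .falsum

theorem and (hP : Expressible m d e u P) (hQ : Expressible m d e u Q) :
    Expressible m d e u (fun W H xs => P W H xs ∧ Q W H xs) :=
  (hP.imp hQ.not).not.congr fun _ _ _ => by tauto

theorem iff (hP : Expressible m d e e P) (hQ : Expressible m d e e Q) :
    Expressible m d e e (fun W H xs => P W H xs ↔ Q W H xs) :=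
  ((hP.imp hQ).and (hQ.imp hP)).congr fun _ _ _ => iff_iff_implies_and_implies.symm

theorem prop (c : Prop) : Expressible m d e u (fun _ _ _ => c) := by
  by_cases hc : c
  · exact (Expressible.falsum.not).congr fun _ _ _ => by simp [hc]
  · exact Expressible.falsum.congr fun _ _ _ => by simp [hc]

theorem forall_finite {ι : Type} [Finite ι] {R : ι → TupleProperty m}
    (h : ∀ i, Expressible m d e u (R i)) :
    Expressible m d e u (fun W H xs => ∀ i, R i W H xs) := by
  classical
  have := Fintype.ofFinite ι
  suffices ∀ s : Finset ι, Expressible m d e u (fun W H xs => ∀ i ∈ s, R i W H xs) from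
    (this Finset.univ).congr fun _ _ _ => by simp only [Finset.mem_univ, forall_const]
  intro s
  induction s using Finset.induction_on with
  | empty => exact (Expressible.prop True).congr fun _ _ _ => by simp
  | insert a s _ ih => exact ((h a).and ih).congr fun _ _ _ => by simp

theorem exists_finite {ι : Type} [Finite ι] {R : ι → TupleProperty m}
    (h : ∀ i, Expressible m d e u (R i)) :
    Expressible m d e u (fun W H xs => ∃ i, R i W H xs) :=
  (forall_finite fun i => (h i).not).not.congr fun _ _ _ => by simp only [not_forall, not_not]

theorem all {R : ∀ W : Type, SimpleGraph W → (Fin m → W) → W → Prop}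
    (h : Expressible (m + 1) d e u
      (fun W H ys => R W H (fun i => ys i.castSucc) (ys (Fin.last m)))) :
    Expressible m (d + 1) (u + 1) u (fun W H xs => ∀ a, R W H xs a) := by
  obtain ⟨φ, hd, -, hu, hφ⟩ := h
  refine ⟨φ.all, Nat.succ_le_succ hd, by simpa [altFrom] using hu, by simpa [altFrom] using hu,
    fun W H v xs => forall_congr' fun a => (hφ W H v _).trans ?_⟩
  simp only [Fin.snoc_castSucc, Fin.snoc_last]

theorem ex {R : ∀ W : Type, SimpleGraph W → (Fin m → W) → W → Prop}
    (h : Expressible (m + 1) d e u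
      (fun W H ys => R W H (fun i => ys i.castSucc) (ys (Fin.last m)))) :
    Expressible m (d + 1) e (e + 1) (fun W H xs => ∃ a, R W H xs a) :=
  (Expressible.all (R := fun W H xs a => ¬ R W H xs a) h.not).not.congr fun _ _ _ => by
    simp only [not_forall, not_not]

theorem exs {k : ℕ} {R : ∀ W : Type, SimpleGraph W → (Fin m → W) → (Fin k → W) → Prop}
    (hue : u ≤ e + 1)
    (h : Expressible (m + k) d e u
      (fun W H ys => R W H (fun i => ys (i.castAdd k)) (fun i => ys (i.natAdd m)))) :
    Expressible m (d + k) e (e + 1) (fun W H xs => ∃ ys, R W H xs ys) := by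
  induction k generalizing d u with
  | zero =>
    refine (h.mono le_rfl le_rfl hue).congr fun W H xs => ⟨fun hR => ⟨_, hR⟩, ?_⟩
    rintro ⟨ys, hR⟩
    rwa [Subsingleton.elim ys fun i => xs (i.natAdd m)] at hR
  | succ k ih =>
    have hlast : Expressible (m + k) (d + 1) e (e + 1) (fun W H zs => ∃ a,
        R W H (fun i => zs (i.castAdd k)) (Fin.snoc (fun i => zs (i.natAdd m)) a)) := by
      refine Expressible.ex (R := fun W H zs a =>
        R W H (fun i => zs (i.castAdd k)) (Fin.snoc (fun i => zs (i.natAdd m)) a))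
        (h.congr fun W H ys => iff_of_eq (congrArg (R W H _) (funext fun i => ?_)))
      induction i using Fin.lastCases with
      | last => rw [Fin.snoc_last]; rfl
      | cast i => rw [Fin.snoc_castSucc]; rfl
    refine ((ih (R := fun W H xs zs => ∃ a, R W H xs (Fin.snoc zs a)) le_rfl hlast).mono
      (by omega) le_rfl le_rfl).congr fun W H xs => ?_
    constructor
    · rintro ⟨zs, a, hR⟩
      exact ⟨_, hR⟩
    · rintro ⟨ys, hR⟩
      exact ⟨Fin.init ys, ys (Fin.last k), by rwa [Fin.snoc_init_self]⟩

end Expressible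

/-- The vertex property `P` is `Expressible` about each entry of a tuple of variables. -/
def VertexExpressible (d e u : ℕ) (P : VertexProperty) : Prop :=
  ∀ (m : ℕ) (i : Fin m), Expressible m d e u (fun W H xs => P W H (xs i))

end Expressibility

section DefiningSentences

variable {V : Type} {d r : ℕ}

/-- In `H`, some vertices with the properties `P v` and `P v'` are related like `v` and `v'`
in `G`. -/
def RelatedAs (G : SimpleGraph V) (P : V → VertexProperty) (v v' : V) (W : Type)
    (H : SimpleGraph W) : Prop :=
  ∃ a b : W, (P v W H a ∧ P v' W H b) ∧ ((a = b ↔ v = v') ∧ (H.Adj a b ↔ G.Adj v v'))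

theorem expressible_relatedAs (G : SimpleGraph V) {P : V → VertexProperty}
    (hP : ∀ v, VertexExpressible d r (r + 1) (P v)) (v v' : V) :
    Expressible 0 (d + 2) r (r + 1) (fun W H _ => RelatedAs G P v v' W H) := by
  refine Expressible.ex (u := r + 1) (R := fun W H _ a => ∃ b : W, (P v W H a ∧ P v' W H b) ∧
    ((a = b ↔ v = v') ∧ (H.Adj a b ↔ G.Adj v v'))) ?_
  refine Expressible.ex (u := r + 1) (R := fun W H xs b =>
    (P v W H (xs (Fin.last 0)) ∧ P v' W H b) ∧
      ((xs (Fin.last 0) = b ↔ v = v') ∧ (H.Adj (xs (Fin.last 0)) b ↔ G.Adj v v'))) ?_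
  exact ((hP v _ _).and (hP v' _ _)).and
    ((Expressible.and (.iff (.eq _ _) (.prop _)) (.iff (.adj _ _) (.prop _))).mono
      le_rfl le_rfl r.le_succ)

theorem nonempty_iso_of_relatedAs {W : Type} {G : SimpleGraph V} {H : SimpleGraph W}
    {P : V → VertexProperty} (hrel : ∀ v v', RelatedAs G P v v' W H)
    (hcover : ∀ a, ∃ v, P v W H a) (hunique : ∀ a b v, P v W H a → P v W H b → a = b) :
    Nonempty (G ≃g H) := by
  have hex (v : V) : ∃ a, P v W H a := by
    obtain ⟨a, -, ⟨ha, -⟩, -⟩ := hrel v v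
    exact ⟨a, ha⟩
  choose f hf using hex
  have hf_rel (v v' : V) : (f v = f v' ↔ v = v') ∧ (H.Adj (f v) (f v') ↔ G.Adj v v') := by
    obtain ⟨a, b, ⟨ha, hb⟩, hab⟩ := hrel v v'
    rwa [hunique _ _ v (hf v) ha, hunique _ _ v' (hf v') hb]
  have hf_bij : Function.Bijective f := by
    refine ⟨fun v v' h => (hf_rel v v').1.1 h, fun a => ?_⟩
    obtain ⟨v, hv⟩ := hcover a
    exact ⟨v, hunique _ _ v (hf v) hv⟩
  exact ⟨⟨Equiv.ofBijective f hf_bij, fun {v v'} => (hf_rel v v').2⟩⟩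

theorem defDepthAlt_le_of_expressible {A : ∀ W : Type, SimpleGraph W → Prop} {G : SimpleGraph V}
    (hA : Expressible 0 d (r + 1) r (fun W H _ => A W H)) (hG : A V G)
    (hiso : ∀ (W : Type) (H : SimpleGraph W), A W H → Nonempty (G ≃g H)) :
    defDepthAlt r G ≤ d := by
  obtain ⟨φ, hd, -, hr, hφ⟩ := hA
  have hdef : Defines φ G :=
    ⟨(hφ V G _ _).2 hG, fun W _ H hGH hH => hGH (hiso W H ((hφ W H _ _).1 hH))⟩
  exact (iInf₂_le φ ⟨hdef, (altFrom_none_le φ _ _).trans hr⟩).trans (by exact_mod_cast hd)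

theorem defDepthAlt_le_of_vertexExpressible [Finite V] (G : SimpleGraph V)
    {P : V → VertexProperty} (hP : ∀ v, VertexExpressible d r (r + 1) (P v))
    (hPG : ∀ v a, P v V G a ↔ a = v) : defDepthAlt (r + 1) G ≤ (d + 2 : ℕ) := by
  have hrel : Expressible 0 (d + 2) (r + 1 + 1) (r + 1)
      (fun W H _ => ∀ v v', RelatedAs G P v v' W H) :=
    .forall_finite fun v => .forall_finite fun v' =>
      (expressible_relatedAs G hP v v').mono le_rfl (by omega) le_rfl
  have hcover : Expressible 0 (d + 2) (r + 1 + 1) (r + 1) (fun W H _ => ∀ a, ∃ v, P v W H a) :=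
    (Expressible.all (R := fun W H _ a => ∃ v, P v W H a)
      (.exists_finite fun v => hP v _ _)).mono (by omega) le_rfl le_rfl
  have hunique : Expressible 0 (d + 2) (r + 1 + 1) (r + 1)
      (fun W H _ => ∀ a b v, P v W H a → P v W H b → a = b) := by
    refine (Expressible.all (e := r + 1) (u := r) (R := fun W H _ a => ∀ b v,
      P v W H a → P v W H b → a = b) ?_).mono le_rfl (by omega) (by omega)
    refine Expressible.all (e := r + 1) (u := r) (R := fun W H xs b => ∀ v,
      P v W H (xs (Fin.last 0)) → P v W H b → xs (Fin.last 0) = b) ?_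
    exact .forall_finite fun v => .imp (hP v _ _) (.imp (hP v _ _) (.eq _ _))
  refine defDepthAlt_le_of_expressible (A := fun W H => (∀ v v', RelatedAs G P v v' W H) ∧
      (∀ a, ∃ v, P v W H a) ∧ ∀ a b v, P v W H a → P v W H b → a = b)
    (hrel.and (hcover.and hunique)) ⟨fun v v' => ?_, fun a => ?_, fun a b v ha hb => ?_⟩
    fun W H h => nonempty_iso_of_relatedAs h.1 h.2.1 h.2.2
  · exact ⟨v, v', ⟨(hPG _ _).2 rfl, (hPG _ _).2 rfl⟩, Iff.rfl, Iff.rfl⟩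
  · exact ⟨a, (hPG _ _).2 rfl⟩
  · rw [(hPG _ _).1 ha, (hPG _ _).1 hb]

theorem defDepthAlt_le_of_marks [Finite V] (G : SimpleGraph V) {ι : Type} [Finite ι] (w : ι → V)
    {M : ι → VertexProperty} (hM : ∀ i, VertexExpressible d r (r + 1) (M i))
    (hMG : ∀ i a, M i V G a ↔ a = w i)
    (hsep : ∀ u v, u ≠ v → ∃ i, ¬ (G.Adj u (w i) ↔ G.Adj v (w i))) :
    defDepthAlt (r + 1) G ≤ (d + 3 : ℕ) := by
  refine defDepthAlt_le_of_vertexExpressible G (d := d + 1)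
    (P := fun v W H a => ∀ i, ∃ b, M i W H b ∧ (H.Adj a b ↔ G.Adj v (w i)))
    (fun v m j => .forall_finite fun i => ?_) fun v a => ⟨fun h => ?_, ?_⟩
  · refine Expressible.ex (u := r + 1) (R := fun W H xs b =>
      M i W H b ∧ (H.Adj (xs j) b ↔ G.Adj v (w i))) ?_
    exact (hM i _ _).and ((Expressible.iff (.adj _ _) (.prop _)).mono le_rfl le_rfl r.le_succ)
  · by_contra hne
    obtain ⟨i, hi⟩ := hsep _ _ hne
    obtain ⟨b, hb, hab⟩ := h i
    rw [(hMG i b).1 hb] at hab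
    exact hi hab
  · rintro rfl i
    exact ⟨w i, (hMG _ _).2 rfl, Iff.rfl⟩

end DefiningSentences

section Pins

variable {V W : Type} {k : ℕ}

/-- `w` is the only common neighbour of the vertices `X i`. -/
def IsUniqueCommonNbr (H : SimpleGraph W) (X : Fin k → W) (w : W) : Prop :=
  ∀ z, (∀ i, H.Adj z (X i)) ↔ z = w

/-- The tuples `X` and `Y` have the same atomic type. -/
def SameType (G : SimpleGraph V) (X : Fin k → V) (H : SimpleGraph W) (Y : Fin k → W) : Prop :=
  ∀ i j, (Y i = Y j ↔ X i = X j) ∧ (H.Adj (Y i) (Y j) ↔ G.Adj (X i) (X j))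

theorem SameType.refl (G : SimpleGraph V) (X : Fin k → V) : SameType G X G X :=
  fun _ _ => ⟨Iff.rfl, Iff.rfl⟩

theorem SameType.symm {G : SimpleGraph V} {X : Fin k → V} {H : SimpleGraph W} {Y : Fin k → W}
    (h : SameType G X H Y) : SameType H Y G X :=
  fun i j => ⟨(h i j).1.symm, (h i j).2.symm⟩

/-- `w` is the only common neighbour of some tuple of the atomic type of `X`. -/
def HasMark (G : SimpleGraph V) (X : Fin k → V) (H : SimpleGraph W) (w : W) : Prop :=
  ∃ Y : Fin k → W, SameType G X H Y ∧ IsUniqueCommonNbr H Y w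

/-- The vertex `w` is pinned by `k` vertices: for the atomic type of some `k`-tuple, it is the only
vertex that is the unique common neighbour of a tuple of this type. -/
def IsPinned (k : ℕ) (G : SimpleGraph V) (w : V) : Prop :=
  ∃ X : Fin k → V, ∀ y, HasMark G X G y ↔ y = w

theorem vertexExpressible_hasMark (G : SimpleGraph V) (X : Fin k → V) :
    VertexExpressible (k + 1) 1 2 (fun _ H w => HasMark G X H w) := by
  intro m i
  have htype : Expressible (m + k) 1 1 1
      (fun _ H ys => SameType G X H (fun i => ys (i.natAdd m))) :=
    .forall_finite fun a => .forall_finite fun b => .and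
      (.iff (.eq _ _) (.prop _)) (.iff (.adj _ _) (.prop _))
  have hnbr : Expressible (m + k) 1 1 1
      (fun _ H ys => IsUniqueCommonNbr H (fun i => ys (i.natAdd m)) (ys (i.castAdd k))) := by
    refine (Expressible.all (d := 0) (e := 0) (u := 0) (R := fun W H ys z =>
      ((∀ j, H.Adj z (ys (Fin.natAdd m j))) ↔ z = ys (i.castAdd k))) ?_).mono le_rfl le_rfl
        zero_le_one
    exact .iff (.forall_finite fun j => .adj _ _) (.eq _ _)
  exact (Expressible.exs (R := fun _ H xs Y => SameType G X H Y ∧ IsUniqueCommonNbr H Y (xs i))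
    (by norm_num) (htype.and hnbr)).mono (by omega) le_rfl le_rfl

theorem defDepthAlt_le_of_isPinned [Finite V] (G : SimpleGraph V)
    (hsep : ∀ u v : V, u ≠ v → ∃ w, IsPinned k G w ∧ ¬ (G.Adj u w ↔ G.Adj v w)) :
    defDepthAlt 2 G ≤ (k + 4 : ℕ) := by
  choose X hX using fun w : {w // IsPinned k G w} => w.2
  refine defDepthAlt_le_of_marks G (Subtype.val : {w // IsPinned k G w} → V)
    (fun w => vertexExpressible_hasMark G (X w)) hX fun u v huv => ?_
  obtain ⟨w, hw, hne⟩ := hsep u v huv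
  exact ⟨⟨w, hw⟩, hne⟩

end Pins

section ExtensionProperty

variable {V W : Type} {M : ℕ} {G : SimpleGraph V} {H : SimpleGraph W}

/-- The `M`-extension property: every adjacency pattern on every set of at most `M` vertices is
realised by a vertex outside the set. -/
def HasExtension (M : ℕ) (G : SimpleGraph V) : Prop :=
  ∀ S T : Finset V, S.card ≤ M → ∃ z ∉ S, ∀ x ∈ S, G.Adj z x ↔ x ∈ T

theorem HasExtension.mono {N : ℕ} (h : HasExtension N G) (hMN : M ≤ N) : HasExtension M G :=
  fun S T hS => h S T (hS.trans hMN)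

theorem SameType.snoc {m : ℕ} {xs : Fin m → V} {ys : Fin m → W} (h : SameType G xs H ys)
    {a : V} {b : W} (heq : ∀ i, ys i = b ↔ xs i = a)
    (hadj : ∀ i, H.Adj b (ys i) ↔ G.Adj a (xs i)) :
    SameType G (Fin.snoc xs a : Fin (m + 1) → V) H (Fin.snoc ys b : Fin (m + 1) → W) := by
  intro i j
  induction i using Fin.lastCases with
  | last =>
    induction j using Fin.lastCases with
    | last => simp
    | cast j => simp [hadj, eq_comm (a := b), eq_comm (a := a), heq]
  | cast i =>
    induction j using Fin.lastCases with
    | last => simp [heq, H.adj_comm _ b, G.adj_comm _ a, hadj]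
    | cast j => simp [h i j]

theorem HasExtension.exists_sameType_snoc (hH : HasExtension M H) {m : ℕ} (hm : m ≤ M)
    {xs : Fin m → V} {ys : Fin m → W} (h : SameType G xs H ys) (a : V) :
    ∃ b : W, SameType G (Fin.snoc xs a : Fin (m + 1) → V) H (Fin.snoc ys b : Fin (m + 1) → W) := by
  classical
  by_cases ha : ∃ i, xs i = a
  · obtain ⟨i, rfl⟩ := ha
    exact ⟨ys i, h.snoc (fun j => (h j i).1) fun j => (h i j).2⟩
  push Not at ha
  obtain ⟨b, hb, hbT⟩ := hH (Finset.univ.image ys)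
    ((Finset.univ.filter fun i => G.Adj a (xs i)).image ys)
    (Finset.card_image_le.trans (by simpa using hm))
  have hb_ne : ∀ i, ys i ≠ b := by simpa using hb
  refine ⟨b, h.snoc (fun i => iff_of_false (hb_ne i) (ha i)) fun i => ?_⟩
  rw [hbT (ys i) (by simp)]
  simp only [Finset.mem_image, Finset.mem_filter, Finset.mem_univ, true_and]
  refine ⟨?_, fun hi => ⟨i, hi, rfl⟩⟩
  rintro ⟨j, hj, hji⟩
  rwa [(h j i).1.1 hji] at hj

theorem exists_eq_var {α : Type} : ∀ t : Language.graph.Term α, ∃ a, t = Term.var a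
  | .var a => ⟨a, rfl⟩
  | .func f _ => f.elim

/-- The strategy of the second player in the Ehrenfeucht game, played on two graphs with the
`M`-extension property: it survives as long as at most `M` vertices have been chosen before a
round. -/
theorem realize_iff_of_sameType (hG : HasExtension M G) (hH : HasExtension M H) (v : Empty → V)
    (v' : Empty → W) {m : ℕ} (φ : Language.graph.BoundedFormula Empty m)
    (hm : m + quantDepth φ ≤ M + 1) {xs : Fin m → V} {ys : Fin m → W} (h : SameType G xs H ys) :
    @BoundedFormula.Realize _ V G.structure _ _ φ v xs ↔
      @BoundedFormula.Realize _ W H.structure _ _ φ v' ys := by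
  induction φ with
  | falsum => exact Iff.rfl
  | equal s t =>
    obtain ⟨⟨⟨⟩⟩ | i, rfl⟩ := exists_eq_var s
    obtain ⟨⟨⟨⟩⟩ | j, rfl⟩ := exists_eq_var t
    exact (h i j).1.symm
  | rel R ts =>
    cases R
    obtain ⟨⟨⟨⟩⟩ | i, hi⟩ := exists_eq_var (ts 0)
    obtain ⟨⟨⟨⟩⟩ | j, hj⟩ := exists_eq_var (ts 1)
    change G.Adj (@Term.realize _ _ G.structure _ _ (ts 0))
      (@Term.realize _ _ G.structure _ _ (ts 1)) ↔ H.Adj (@Term.realize _ _ H.structure _ _ (ts 0))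
      (@Term.realize _ _ H.structure _ _ (ts 1))
    rw [hi, hj]
    exact (h i j).2.symm
  | imp φ ψ ihφ ihψ =>
    simp only [quantDepth] at hm
    exact imp_congr (ihφ (by omega) h) (ihψ (by omega) h)
  | all φ ih =>
    simp only [quantDepth] at hm
    constructor
    · intro hall b
      obtain ⟨a, ha⟩ := hG.exists_sameType_snoc (by omega) h.symm b
      exact (ih (by omega) ha.symm).1 (hall a)
    · intro hall a
      obtain ⟨b, hb⟩ := hH.exists_sameType_snoc (by omega) h a
      exact (ih (by omega) hb).2 (hall b)

theorem HasExtension.le_defDepth [Finite W] (hG : HasExtension M G) (hH : HasExtension M H)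
    (hGH : ¬ Nonempty (G ≃g H)) : (M + 2 : ℕ) ≤ defDepth G := by
  refine le_iInf₂ fun A hA => ?_
  by_contra! hlt
  have hdepth : quantDepth A < M + 2 := by exact_mod_cast hlt
  exact hA.2 W H hGH
    ((realize_iff_of_sameType hG hH _ _ A (by omega) (fun i => i.elim0)).1 hA.1)

theorem defDepth_le_defDepthAlt (r : ℕ) (G : SimpleGraph V) : defDepth G ≤ defDepthAlt r G :=
  le_iInf₂ fun A hA => iInf₂_le A hA.1

end ExtensionProperty

section Indicator

open Classical in
/-- The indicator of a proposition, so that `𝔼 ω, ind (P ω)` is the probability of the event `P`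
for a uniformly random `ω`. -/
noncomputable def ind (p : Prop) : ℝ := if p then 1 else 0

theorem ind_of_true {p : Prop} (h : p) : ind p = 1 := if_pos h

theorem ind_of_false {p : Prop} (h : ¬ p) : ind p = 0 := if_neg h

theorem ind_nonneg (p : Prop) : 0 ≤ ind p := by
  unfold ind; split_ifs <;> norm_num

theorem ind_mono {p q : Prop} (h : p → q) : ind p ≤ ind q := by
  by_cases hp : p
  · rw [ind_of_true hp, ind_of_true (h hp)]
  · exact (ind_of_false hp).trans_le (ind_nonneg q)

theorem ind_le_one (p : Prop) : ind p ≤ 1 :=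
  (ind_mono fun _ => trivial).trans_eq (ind_of_true trivial)

theorem ind_and (p q : Prop) : ind (p ∧ q) = ind p * ind q := by
  by_cases hp : p <;> by_cases hq : q <;> simp [ind, hp, hq]

theorem ind_or_le (p q : Prop) : ind (p ∨ q) ≤ ind p + ind q := by
  by_cases hp : p <;> by_cases hq : q <;> simp [ind, hp, hq]

theorem ind_not (p : Prop) : ind (¬ p) = 1 - ind p := by
  by_cases hp : p <;> simp [ind, hp]

theorem ind_congr {p q : Prop} (h : p ↔ q) : ind p = ind q := by rw [propext h]

theorem ind_forall {ι : Type*} (s : Finset ι) (p : ι → Prop) :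
    ind (∀ i ∈ s, p i) = ∏ i ∈ s, ind (p i) := by
  classical
  induction s using Finset.induction_on with
  | empty => simp [ind]
  | insert a s ha ih => rw [Finset.prod_insert ha, ← ih, ← ind_and, Finset.forall_mem_insert]

theorem ind_exists_le {ι : Type*} (s : Finset ι) (p : ι → Prop) :
    ind (∃ i ∈ s, p i) ≤ ∑ i ∈ s, ind (p i) := by
  by_cases h : ∃ i ∈ s, p i
  · obtain ⟨i, hi, hp⟩ := h
    calc ind (∃ i ∈ s, p i) ≤ ind (p i) := ind_mono fun _ => hp
      _ ≤ _ := Finset.single_le_sum (f := fun i => ind (p i)) (fun i _ => ind_nonneg _) hi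
  · exact (ind_of_false h).trans_le (Finset.sum_nonneg fun i _ => ind_nonneg _)

theorem sum_ind_eq_card {ι : Type*} [Fintype ι] (p : ι → Prop) [DecidablePred p] :
    ∑ i, ind (p i) = (Finset.univ.filter p).card := by
  rw [Finset.card_filter, Nat.cast_sum]
  exact Finset.sum_congr rfl fun i _ => by by_cases h : p i <;> simp [ind, h]

end Indicator

section Moments

variable {Ω : Type*} [Fintype Ω] {Y : Ω → ℝ}

theorem expect_ind_le_of_markov (hY : ∀ ω, 0 ≤ Y ω) {a : ℝ} (ha : 0 < a) :
    𝔼 ω, ind (a ≤ Y ω) ≤ (𝔼 ω, Y ω) / a := by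
  rw [le_div_iff₀ ha, Finset.expect_mul]
  refine Finset.expect_le_expect fun ω _ => ?_
  by_cases h : a ≤ Y ω
  · rwa [ind_of_true h, one_mul]
  · rw [ind_of_false h, zero_mul]
    exact hY ω

theorem expect_sub_expect_sq [Nonempty Ω] :
    𝔼 ω, (Y ω - 𝔼 ω, Y ω) ^ 2 = 𝔼 ω, Y ω ^ 2 - (𝔼 ω, Y ω) ^ 2 := by
  set μ := 𝔼 ω, Y ω
  calc 𝔼 ω, (Y ω - μ) ^ 2 = 𝔼 ω, (Y ω ^ 2 - 2 * μ * Y ω + μ ^ 2) :=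
        Finset.expect_congr rfl fun ω _ => by ring
    _ = 𝔼 ω, Y ω ^ 2 - 2 * μ * μ + μ ^ 2 := by
        rw [Finset.expect_add_distrib, Finset.expect_sub_distrib, ← Finset.mul_expect,
          Fintype.expect_const]
    _ = _ := by ring

theorem expect_ind_le_half_of_chebyshev [Nonempty Ω] (hY : 0 < 𝔼 ω, Y ω) :
    𝔼 ω, ind (Y ω ≤ (𝔼 ω, Y ω) / 2) ≤ 4 * ((𝔼 ω, Y ω ^ 2) / (𝔼 ω, Y ω) ^ 2 - 1) := by
  have hvar := expect_sub_expect_sq (Y := Y)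
  set μ := 𝔼 ω, Y ω
  calc 𝔼 ω, ind (Y ω ≤ μ / 2) ≤ 𝔼 ω, ind ((μ / 2) ^ 2 ≤ (Y ω - μ) ^ 2) :=
        Finset.expect_le_expect fun ω _ => ind_mono fun h => by nlinarith
    _ ≤ (𝔼 ω, (Y ω - μ) ^ 2) / (μ / 2) ^ 2 :=
        expect_ind_le_of_markov (fun ω => sq_nonneg _) (by positivity)
    _ = 4 * ((𝔼 ω, Y ω ^ 2) / μ ^ 2 - 1) := by
        rw [hvar]
        field_simp
        norm_num

end Moments

section Independence

variable {E ι β : Type*} {s : Finset ι}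

theorem dependsOn_ind {P : (E → β) → Prop} {S : Set E} (h : DependsOn P S) :
    DependsOn (fun f => ind (P f)) S :=
  fun _ _ hfg => congrArg ind (h hfg)

theorem dependsOn_finset_prod {F : ι → (E → β) → ℝ} {D : ι → Set E}
    (h : ∀ i ∈ s, DependsOn (F i) (D i)) :
    DependsOn (fun f => ∏ i ∈ s, F i f) (⋃ i ∈ s, D i) :=
  fun _ _ hfg => Finset.prod_congr rfl fun i hi =>
    h i hi fun e he => hfg e (Set.mem_biUnion hi he)

variable [Fintype E] [DecidableEq E] [Fintype β] [Nonempty β]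

theorem expect_eq_expect_piecewise (S : Set E) [DecidablePred (· ∈ S)] (K : (E → β) → ℝ) :
    𝔼 f, K f = 𝔼 g, 𝔼 f, K (S.piecewise f g) := by
  have hinv : Function.Involutive fun p : (E → β) × (E → β) =>
      (S.piecewise p.1 p.2, S.piecewise p.2 p.1) := by
    rintro ⟨f, g⟩
    ext e <;> by_cases he : e ∈ S <;> simp [he]
  calc 𝔼 f, K f = 𝔼 f, 𝔼 _g : E → β, K f := by simp only [Fintype.expect_const]
    _ = 𝔼 p : (E → β) × (E → β), K p.1 := by
        rw [← Finset.univ_product_univ, Finset.expect_product]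
    _ = 𝔼 p : (E → β) × (E → β), K (S.piecewise p.1 p.2) :=
        (Fintype.expect_equiv (hinv.toPerm _) _ _ fun _ => rfl).symm
    _ = 𝔼 g, 𝔼 f, K (S.piecewise f g) := by
        rw [← Finset.univ_product_univ, Finset.expect_product, Finset.expect_comm]

theorem expect_mul_of_dependsOn {F G : (E → β) → ℝ} {S T : Set E} (hF : DependsOn F S)
    (hG : DependsOn G T) (hST : Disjoint S T) :
    𝔼 f, F f * G f = (𝔼 f, F f) * 𝔼 f, G f := by
  classical
  have hFG (f g : E → β) : F (S.piecewise f g) * G (S.piecewise f g) = F f * G g := by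
    congr 1
    · exact hF fun e he => by simp [he]
    · exact hG fun e he => by simp [Set.disjoint_right.1 hST he]
  rw [expect_eq_expect_piecewise S]
  simp_rw [hFG, ← Finset.expect_mul, ← Finset.mul_expect]

theorem expect_prod_of_dependsOn {F : ι → (E → β) → ℝ} {D : ι → Set E}
    (hF : ∀ i ∈ s, DependsOn (F i) (D i))
    (hD : (s : Set ι).PairwiseDisjoint D) :
    𝔼 f, ∏ i ∈ s, F i f = ∏ i ∈ s, 𝔼 f, F i f := by
  classical
  induction s using Finset.induction_on with
  | empty => simp
  | insert a s ha ih =>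
    rw [Finset.coe_insert, Set.pairwiseDisjoint_insert_of_notMem (by simpa using ha)] at hD
    have hF' : ∀ i ∈ s, DependsOn (F i) (D i) := fun i hi => hF i (Finset.mem_insert_of_mem hi)
    simp_rw [Finset.prod_insert ha]
    rw [expect_mul_of_dependsOn (hF a (Finset.mem_insert_self _ _)) (dependsOn_finset_prod hF')
      (Set.disjoint_iUnion₂_right.2 hD.2), ih hF' hD.1]

end Independence

section RandomBits

variable {E ι : Type*} [Fintype E] [DecidableEq E] {s : Finset ι} {g : ι → E}

theorem expect_ind_apply_eq (e : E) (c : Bool) : 𝔼 f : E → Bool, ind (f e = c) = 1 / 2 := by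
  have hinv : Function.Involutive fun f : E → Bool => Function.update f e (!f e) := by
    intro f
    simp
  have hflip : 𝔼 f : E → Bool, ind (f e = c) = 1 - 𝔼 f : E → Bool, ind (f e = c) :=
    calc 𝔼 f : E → Bool, ind (f e = c) = 𝔼 f : E → Bool, ind (¬ f e = c) :=
          Fintype.expect_equiv (hinv.toPerm _) _ _ fun f => ind_congr (by simp)
      _ = 1 - 𝔼 f : E → Bool, ind (f e = c) := by
          simp_rw [ind_not, Finset.expect_sub_distrib, Fintype.expect_const]
  linarith

theorem expect_ind_forall_eq (hg : Set.InjOn g s) (b : ι → Bool) :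
    𝔼 f : E → Bool, ind (∀ i ∈ s, f (g i) = b i) = (1 / 2) ^ s.card := by
  simp_rw [ind_forall]
  rw [expect_prod_of_dependsOn (D := fun i => {g i})]
  · simp_rw [expect_ind_apply_eq, Finset.prod_const]
  · exact fun i _ f f' h => congrArg (fun c => ind (c = b i)) (h (g i) rfl)
  · exact fun i hi j hj hij => Set.disjoint_singleton.2 fun h => hij (hg hi hj h)

theorem expect_mul_ind_forall_eq (hg : Set.InjOn g s) {K : (E → Bool) → ℝ}
    {b : (E → Bool) → ι → Bool} (hK : DependsOn K (g '' s)ᶜ)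
    (hb : ∀ i ∈ s, DependsOn (fun f => b f i) (g '' s)ᶜ) :
    𝔼 f, K f * ind (∀ i ∈ s, f (g i) = b f i) = (𝔼 f, K f) * (1 / 2) ^ s.card := by
  classical
  have hresample (f f' : E → Bool) : K ((g '' s).piecewise f f') * ind (∀ i ∈ s,
      (g '' s).piecewise f f' (g i) = b ((g '' s).piecewise f f') i) =
        K f' * ind (∀ i ∈ s, f (g i) = b f' i) := by
    have hout : ∀ e ∈ (g '' s)ᶜ, (g '' s).piecewise f f' e = f' e :=
      fun e he => Set.piecewise_eq_of_notMem _ _ _ he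
    congr 1
    · exact hK hout
    · refine ind_congr (forall₂_congr fun i hi => ?_)
      rw [show b ((g '' s).piecewise f f') i = b f' i from hb i hi hout,
        Set.piecewise_eq_of_mem _ _ _ (Set.mem_image_of_mem g hi)]
  rw [expect_eq_expect_piecewise (g '' s)]
  simp_rw [hresample, ← Finset.mul_expect, expect_ind_forall_eq hg, ← Finset.expect_mul]

end RandomBits

section RandomGraph

variable {V : Type*}

/-- The graph whose edges are the pairs `e` with `f e = true`; the values of `f` on the diagonal
play no role, and a uniformly random `f` gives the random graph of edge probability `1/2`. -/
def graphOf (f : Sym2 V → Bool) : SimpleGraph V := SimpleGraph.fromEdgeSet {e | f e = true}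

theorem graphOf_adj (f : Sym2 V → Bool) (u v : V) :
    (graphOf f).Adj u v ↔ f s(u, v) = true ∧ u ≠ v := by
  simp [graphOf]

theorem graphOf_eq_iff {f : Sym2 V → Bool} {G : SimpleGraph V} :
    graphOf f = G ↔ ∀ e, ¬ e.IsDiag → (f e = true ↔ e ∈ G.edgeSet) := by
  refine ⟨?_, fun h => ?_⟩
  · rintro rfl ⟨u, v⟩ huv
    simpa [graphOf_adj] using fun _ => huv
  · ext u v
    rw [graphOf_adj]
    refine ⟨fun ⟨hf, huv⟩ => (h s(u, v) (by simpa using huv)).1 hf, fun hG => ?_⟩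
    exact ⟨(h s(u, v) (by simpa using hG.ne)).2 hG, hG.ne⟩

theorem measurableSingletonClass_simpleGraph [Countable V] :
    MeasurableSingletonClass (SimpleGraph V) := by
  refine ⟨fun G => ?_⟩
  have hG : ({G} : Set (SimpleGraph V)) = SimpleGraph.Adj ⁻¹' {G.Adj} := by
    ext H
    simp
  rw [hG]
  exact SimpleGraph.measurable_adj (measurableSet_singleton _)

variable [Fintype V]

theorem binomialRandom_half_real_singleton (G : SimpleGraph V) :
    (SimpleGraph.binomialRandom V half).real {G} = (1 / 2) ^ (Fintype.card V).choose 2 := by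
  classical
  have hle : G.edgeSet.ncard ≤ (Nat.card V).choose 2 := by
    rw [Nat.card_eq_fintype_card, ← Sym2.card_diagSet_compl, Fintype.card_eq_nat_card,
      Nat.card_coe_set_eq]
    exact Set.ncard_le_ncard G.edgeSet_subset_compl_diagSet (Set.toFinite _)
  have hhalf : (unitInterval.toNNReal half : ℝ) = 1 / 2 := rfl
  have hhalf_symm : (unitInterval.toNNReal (unitInterval.symm half) : ℝ) = 1 / 2 := by
    change (1 : ℝ) - 1 / 2 = 1 / 2
    norm_num
  rw [MeasureTheory.Measure.real, SimpleGraph.binomialRandom_singleton]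
  simp only [ENNReal.toReal_mul, ENNReal.toReal_pow, ENNReal.coe_toReal, hhalf, hhalf_symm]
  rw [← pow_add, Nat.add_sub_cancel' hle, Nat.card_eq_fintype_card]

theorem expect_ind_graphOf_eq [DecidableEq V] (G : SimpleGraph V) :
    𝔼 f : Sym2 V → Bool, ind (graphOf f = G) = (1 / 2) ^ (Fintype.card V).choose 2 := by
  classical
  have hcard : (Finset.univ.filter fun e : Sym2 V => ¬ e.IsDiag).card =
      (Fintype.card V).choose 2 := by
    rw [← Fintype.card_subtype, Sym2.card_subtype_not_diag]
  rw [← hcard, ← expect_ind_forall_eq (E := Sym2 V) (Set.injOn_id _)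
    (fun e => decide (e ∈ G.edgeSet))]
  refine Finset.expect_congr rfl fun f _ => ind_congr ?_
  rw [graphOf_eq_iff]
  simp only [Finset.mem_filter, Finset.mem_univ, true_and, id_eq]
  exact forall₂_congr fun e _ => by cases f e <;> simp

theorem prob_eq_expect (n : ℕ) (P : SimpleGraph (Fin n) → Prop) :
    prob n P = 𝔼 f : Sym2 (Fin n) → Bool, ind (P (graphOf f)) := by
  classical
  have := measurableSingletonClass_simpleGraph (V := Fin n)
  calc prob n P = ∑ G ∈ Finset.univ.filter P,
        (SimpleGraph.binomialRandom (Fin n) half).real {G} := by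
        rw [MeasureTheory.sum_measureReal_singleton, prob, Finset.coe_filter]
        simp only [Finset.mem_univ, true_and]
    _ = ∑ G ∈ Finset.univ.filter P, 𝔼 f : Sym2 (Fin n) → Bool, ind (graphOf f = G) := by
        simp_rw [binomialRandom_half_real_singleton, expect_ind_graphOf_eq]
    _ = 𝔼 f : Sym2 (Fin n) → Bool, ∑ G ∈ Finset.univ.filter P, ind (graphOf f = G) :=
        (Finset.expect_sum_comm ..).symm
    _ = 𝔼 f : Sym2 (Fin n) → Bool, ind (P (graphOf f)) :=
        Finset.expect_congr rfl fun f _ => by simp [ind, Finset.sum_ite_eq]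

theorem prob_mono {n : ℕ} {P Q : SimpleGraph (Fin n) → Prop} (h : ∀ G, P G → Q G) :
    prob n P ≤ prob n Q := by
  rw [prob_eq_expect, prob_eq_expect]
  exact Finset.expect_le_expect fun f _ => ind_mono (h _)

theorem prob_le_one (n : ℕ) (P : SimpleGraph (Fin n) → Prop) : prob n P ≤ 1 := by
  rw [prob_eq_expect]
  exact (Finset.expect_le_expect fun f _ => ind_le_one _).trans_eq (Fintype.expect_const 1)

end RandomGraph

section Stars

variable {V : Type*}

/-- The pairs joining `z` to the set `S`. -/
def star (z : V) (S : Finset V) : Set (Sym2 V) := (fun x => s(z, x)) '' S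

theorem star_mono (z : V) {S T : Finset V} (h : S ⊆ T) : star z S ⊆ star z T :=
  Set.image_mono (by exact_mod_cast h)

theorem disjoint_star {z z' : V} {S : Finset V} (hz : z ∉ S) (h : z ≠ z') :
    Disjoint (star z S) (star z' S) := by
  rw [Set.disjoint_left]
  rintro _ ⟨x, -, rfl⟩ ⟨y, hy, hxy⟩
  rcases Sym2.eq_iff.1 hxy with ⟨rfl, -⟩ | ⟨-, rfl⟩
  · exact h rfl
  · exact hz hy

/-- The vertex `z` is joined to the vertices of `S` according to the pattern `b`. -/
def HasTrace (b : V → Bool) (S : Finset V) (z : V) (f : Sym2 V → Bool) : Prop :=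
  ∀ x ∈ S, f s(z, x) = b x

theorem dependsOn_hasTrace (b : V → Bool) {S T : Finset V} (hST : S ⊆ T) (z : V) :
    DependsOn (HasTrace b S z) (star z T) := fun f g h =>
  propext <| forall₂_congr fun x hx => by rw [h _ (star_mono z hST ⟨x, hx, rfl⟩)]

theorem dependsOn_not {E : Type*} {P : (E → Bool) → Prop} {D : Set E} (h : DependsOn P D) :
    DependsOn (fun f => ¬ P f) D :=
  fun _ _ hfg => congrArg Not (h hfg)

theorem dependsOn_and {E : Type*} {P Q : (E → Bool) → Prop} {D : Set E} (hP : DependsOn P D)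
    (hQ : DependsOn Q D) : DependsOn (fun f => P f ∧ Q f) D :=
  fun _ _ hfg => congrArg₂ And (hP hfg) (hQ hfg)

variable [DecidableEq V]

theorem hasTrace_union {b : V → Bool} {S T : Finset V} {z : V} {f : Sym2 V → Bool} :
    HasTrace b (S ∪ T) z f ↔ HasTrace b S z f ∧ HasTrace b T z f :=
  Finset.forall_mem_union

theorem dependsOn_not_hasTrace_and_not_hasTrace (b : V → Bool) (S T : Finset V) (z : V) :
    DependsOn (fun f => ¬ HasTrace b S z f ∧ ¬ HasTrace b T z f) (star z (S ∪ T)) :=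
  dependsOn_and (dependsOn_not (dependsOn_hasTrace b Finset.subset_union_left z))
    (dependsOn_not (dependsOn_hasTrace b Finset.subset_union_right z))

variable [Fintype V]

theorem expect_ind_hasTrace (b : V → Bool) (S : Finset V) (z : V) :
    𝔼 f, ind (HasTrace b S z f) = (1 / 2) ^ S.card :=
  expect_ind_forall_eq (fun _ _ _ _ h => Sym2.congr_right.1 h) b

theorem expect_ind_not_hasTrace (b : V → Bool) (S : Finset V) (z : V) :
    𝔼 f, ind (¬ HasTrace b S z f) = 1 - (1 / 2) ^ S.card := by
  simp_rw [ind_not, Finset.expect_sub_distrib, Fintype.expect_const, expect_ind_hasTrace]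

theorem expect_ind_not_hasTrace_and_not_hasTrace (b : V → Bool) (S T : Finset V) (z : V) :
    𝔼 f, ind (¬ HasTrace b S z f ∧ ¬ HasTrace b T z f) =
      1 - (1 / 2) ^ S.card - (1 / 2) ^ T.card + (1 / 2) ^ (S ∪ T).card := by
  have hind (f : Sym2 V → Bool) : ind (¬ HasTrace b S z f ∧ ¬ HasTrace b T z f) =
      1 - ind (HasTrace b S z f) - ind (HasTrace b T z f) + ind (HasTrace b (S ∪ T) z f) := by
    rw [ind_congr hasTrace_union, ind_and, ind_and, ind_not, ind_not]
    ring
  simp_rw [hind, Finset.expect_add_distrib, Finset.expect_sub_distrib, Fintype.expect_const,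
    expect_ind_hasTrace]

section Independence

variable {S Z : Finset V} {R : V → (Sym2 V → Bool) → Prop}

theorem expect_ind_forall_of_dependsOn_star (hSZ : Disjoint S Z)
    (hR : ∀ z ∈ Z, DependsOn (R z) (star z S)) :
    𝔼 f, ind (∀ z ∈ Z, R z f) = ∏ z ∈ Z, 𝔼 f, ind (R z f) := by
  simp_rw [ind_forall]
  exact expect_prod_of_dependsOn (fun z hz => dependsOn_ind (hR z hz))
    fun z hz z' _ h => disjoint_star (Finset.disjoint_right.1 hSZ hz) h

theorem expect_ind_and_forall_of_dependsOn_star {w : V} {P : (Sym2 V → Bool) → Prop}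
    (hSZ : Disjoint S Z) (hwS : w ∉ S) (hwZ : w ∉ Z) (hP : DependsOn P (star w S))
    (hR : ∀ z ∈ Z, DependsOn (R z) (star z S)) :
    𝔼 f, ind (P f ∧ ∀ z ∈ Z, R z f) = (𝔼 f, ind (P f)) * ∏ z ∈ Z, 𝔼 f, ind (R z f) := by
  simp_rw [ind_and, ind_forall]
  rw [expect_mul_of_dependsOn (dependsOn_ind hP)
    (dependsOn_finset_prod fun z hz => dependsOn_ind (hR z hz))
    (Set.disjoint_iUnion₂_right.2 fun z hz => disjoint_star hwS fun h => hwZ (h ▸ hz))]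
  simp_rw [← ind_forall]
  rw [expect_ind_forall_of_dependsOn_star hSZ hR]

end Independence

end Stars

section ExtensionProbability

variable {V : Type} [Fintype V] [DecidableEq V]

theorem expect_ind_forall_not_hasTrace (b : V → Bool) (S : Finset V) :
    𝔼 f, ind (∀ z ∈ Sᶜ, ¬ HasTrace b S z f) =
      (1 - (1 / 2) ^ S.card) ^ (Fintype.card V - S.card) := by
  rw [expect_ind_forall_of_dependsOn_star disjoint_compl_right
    fun z _ => dependsOn_not (dependsOn_hasTrace b subset_rfl z)]
  simp_rw [expect_ind_not_hasTrace, Finset.prod_const, Finset.card_compl]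

theorem exists_forall_not_hasTrace_of_not_hasExtension {M : ℕ} (hM : M ≤ Fintype.card V)
    {f : Sym2 V → Bool} (h : ¬ HasExtension M (graphOf f)) :
    ∃ S ∈ Finset.univ.powersetCard M, ∃ T ∈ S.powerset,
      ∀ z ∈ Sᶜ, ¬ HasTrace (fun x => decide (x ∈ T)) S z f := by
  unfold HasExtension at h
  push Not at h
  obtain ⟨S₀, T₀, hS₀, h⟩ := h
  obtain ⟨S, hS, hcard⟩ := Finset.exists_superset_card_eq hS₀ hM
  refine ⟨S, Finset.mem_powersetCard.2 ⟨Finset.subset_univ _, hcard⟩, T₀ ∩ S,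
    Finset.mem_powerset.2 Finset.inter_subset_right, fun z hz htrace => ?_⟩
  rw [Finset.mem_compl] at hz
  obtain ⟨x, hx, hzx⟩ := h z fun h => hz (hS h)
  have hne : z ≠ x := fun h => hz (h ▸ hS hx)
  simp [graphOf_adj, htrace x (hS hx), hne, hS hx] at hzx

theorem one_sub_half_pow_nonneg (m : ℕ) : (0 : ℝ) ≤ 1 - (1 / 2) ^ m :=
  sub_nonneg.2 (pow_le_one₀ (by norm_num) (by norm_num))

theorem expect_ind_not_hasExtension_le {M : ℕ} (hM : M ≤ Fintype.card V) :
    𝔼 f : Sym2 V → Bool, ind (¬ HasExtension M (graphOf f)) ≤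
      (2 * Fintype.card V) ^ M * (1 - (1 / 2) ^ M) ^ (Fintype.card V - M) := by
  have hnonneg := one_sub_half_pow_nonneg M
  have hpattern : ∀ S ∈ Finset.univ.powersetCard M, ∑ T ∈ S.powerset,
      𝔼 f : Sym2 V → Bool, ind (∀ z ∈ Sᶜ, ¬ HasTrace (fun x => decide (x ∈ T)) S z f) =
        2 ^ M * (1 - (1 / 2) ^ M) ^ (Fintype.card V - M) := by
    intro S hS
    simp_rw [expect_ind_forall_not_hasTrace, Finset.sum_const, Finset.card_powerset,
      (Finset.mem_powersetCard.1 hS).2, nsmul_eq_mul, Nat.cast_pow, Nat.cast_ofNat]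
  calc 𝔼 f : Sym2 V → Bool, ind (¬ HasExtension M (graphOf f))
      ≤ 𝔼 f : Sym2 V → Bool, ∑ S ∈ Finset.univ.powersetCard M, ∑ T ∈ S.powerset,
          ind (∀ z ∈ Sᶜ, ¬ HasTrace (fun x => decide (x ∈ T)) S z f) :=
        Finset.expect_le_expect fun f _ =>
          (ind_mono (exists_forall_not_hasTrace_of_not_hasExtension hM)).trans <|
            (ind_exists_le _ _).trans (Finset.sum_le_sum fun S _ => ind_exists_le _ _)
    _ = (Fintype.card V).choose M * (2 ^ M * (1 - (1 / 2) ^ M) ^ (Fintype.card V - M)) := by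
        simp_rw [Finset.expect_sum_comm]
        rw [Finset.sum_congr rfl hpattern, Finset.sum_const, Finset.card_powersetCard,
          Finset.card_univ, nsmul_eq_mul]
    _ ≤ (Fintype.card V) ^ M * (2 ^ M * (1 - (1 / 2) ^ M) ^ (Fintype.card V - M)) := by
        gcongr
        exact_mod_cast Nat.choose_le_pow (Fintype.card V) M
    _ = _ := by rw [mul_pow]; ring

end ExtensionProbability

section Isolation

variable {V : Type*} [Fintype V] [DecidableEq V]

/-- In the random graph, `w` is joined to all of `S`, and no other vertex outside `S` is. -/
def Isolates (S : Finset V) (w : V) (f : Sym2 V → Bool) : Prop :=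
  HasTrace (fun _ => true) S w f ∧ ∀ z ∈ (insert w S)ᶜ, ¬ HasTrace (fun _ => true) S z f

theorem expect_ind_isolates {S : Finset V} {w : V} (hw : w ∉ S) :
    𝔼 f, ind (Isolates S w f) =
      (1 / 2) ^ S.card * (1 - (1 / 2) ^ S.card) ^ (Fintype.card V - (S.card + 1)) := by
  unfold Isolates
  rw [expect_ind_and_forall_of_dependsOn_star (disjoint_compl_right.mono_left <|
    Finset.subset_insert w S) hw (by simp)
    (dependsOn_hasTrace _ subset_rfl w)
    fun z _ => dependsOn_not (dependsOn_hasTrace _ subset_rfl z)]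
  simp_rw [expect_ind_not_hasTrace, Finset.prod_const, Finset.card_compl, expect_ind_hasTrace,
    Finset.card_insert_of_notMem hw]

theorem expect_ind_isolates_mul_le {S T : Finset V} {w : V} (hS : w ∉ S) (hT : w ∉ T) :
    𝔼 f, ind (Isolates S w f) * ind (Isolates T w f) ≤
      (1 / 2) ^ (S ∪ T).card * (1 - (1 / 2) ^ S.card - (1 / 2) ^ T.card +
        (1 / 2) ^ (S ∪ T).card) ^ (Fintype.card V - ((S ∪ T).card + 1)) := by
  have hw : w ∉ S ∪ T := by simp [hS, hT]
  have himp (f : Sym2 V → Bool) : Isolates S w f ∧ Isolates T w f →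
      HasTrace (fun _ => true) (S ∪ T) w f ∧ ∀ z ∈ (insert w (S ∪ T))ᶜ,
        ¬ HasTrace (fun _ => true) S z f ∧ ¬ HasTrace (fun _ => true) T z f := by
    rintro ⟨⟨hSw, hSz⟩, hTw, hTz⟩
    refine ⟨hasTrace_union.2 ⟨hSw, hTw⟩, fun z hz => ⟨hSz z ?_, hTz z ?_⟩⟩ <;>
      simp only [Finset.mem_compl, Finset.mem_insert, Finset.mem_union] at hz ⊢ <;> tauto
  simp_rw [← ind_and]
  refine (Finset.expect_le_expect fun f _ => ind_mono (himp f)).trans_eq ?_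
  rw [expect_ind_and_forall_of_dependsOn_star (disjoint_compl_right.mono_left <|
    Finset.subset_insert w _) hw (by simp)
    (dependsOn_hasTrace _ subset_rfl w)
    fun z _ => dependsOn_not_hasTrace_and_not_hasTrace _ S T z]
  simp_rw [expect_ind_not_hasTrace_and_not_hasTrace, Finset.prod_const, Finset.card_compl,
    expect_ind_hasTrace, Finset.card_insert_of_notMem hw]

end Isolation

section Coincidence

variable {k : ℕ}

/-- The pairs of distinct indices of which at least one lies outside `J`. -/
def pairsLeaving (J : Finset (Fin k)) : Finset (Sym2 (Fin k)) :=
  (Finset.univ.offDiag.image Sym2.mk.uncurry) \ (J.offDiag.image Sym2.mk.uncurry)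

theorem mem_pairsLeaving {J : Finset (Fin k)} {a b : Fin k} :
    s(a, b) ∈ pairsLeaving J ↔ a ≠ b ∧ ¬ (a ∈ J ∧ b ∈ J) := by
  have hmem (I : Finset (Fin k)) : s(a, b) ∈ I.offDiag.image Sym2.mk.uncurry ↔
      a ∈ I ∧ b ∈ I ∧ a ≠ b := by
    simp only [Finset.mem_image, Finset.mem_offDiag, Prod.exists, Function.uncurry_apply_pair]
    constructor
    · rintro ⟨c, d, ⟨hc, hd, hcd⟩, h⟩
      rcases Sym2.eq_iff.1 h with ⟨rfl, rfl⟩ | ⟨rfl, rfl⟩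
      · exact ⟨hc, hd, hcd⟩
      · exact ⟨hd, hc, hcd.symm⟩
    · exact fun h => ⟨a, b, h, rfl⟩
  rw [pairsLeaving, Finset.mem_sdiff, hmem, hmem]
  simp only [Finset.mem_univ, true_and]
  tauto

theorem card_pairsLeaving (J : Finset (Fin k)) :
    (pairsLeaving J).card = k.choose 2 - J.card.choose 2 := by
  rw [pairsLeaving, Finset.card_sdiff_of_subset, Sym2.card_image_offDiag, Sym2.card_image_offDiag,
    Finset.card_univ, Fintype.card_fin]
  exact Finset.image_subset_image (Finset.offDiag_mono (Finset.subset_univ J))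

variable {V : Type*}

theorem star_subset_compl_map_image {Y : Fin k ↪ V} {z : V} (hz : z ∉ Finset.univ.map Y)
    (S : Finset V) (P : Set (Sym2 (Fin k))) : star z S ⊆ (Sym2.map Y '' P)ᶜ := by
  rintro _ ⟨x, -, rfl⟩ ⟨p, -, hp⟩
  have hzp : z ∈ Sym2.map Y p := hp ▸ Sym2.mem_mk_left z x
  obtain ⟨a, -, rfl⟩ := Sym2.mem_map.1 hzp
  exact hz (Finset.mem_map_of_mem Y (Finset.mem_univ a))

variable [DecidableEq V]

theorem map_notMem_map_pairsLeaving (X Y : Fin k ↪ V) (p : Sym2 (Fin k)) :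
    Sym2.map X p ∉ Sym2.map Y ''
      pairsLeaving (Finset.univ.filter fun a => Y a ∈ Finset.univ.map X) := by
  rintro ⟨q, hq, hqp⟩
  have hYX : ∀ a ∈ q, Y a ∈ Finset.univ.map X := by
    intro a ha
    have hYa : Y a ∈ Sym2.map X p := hqp ▸ Sym2.mem_map.2 ⟨a, ha, rfl⟩
    obtain ⟨b, -, hb⟩ := Sym2.mem_map.1 hYa
    exact hb ▸ Finset.mem_map_of_mem X (Finset.mem_univ b)
  induction q with
  | _ a b =>
    exact (mem_pairsLeaving.1 hq).2
      ⟨Finset.mem_filter.2 ⟨Finset.mem_univ a, hYX a (Sym2.mem_mk_left a b)⟩,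
        Finset.mem_filter.2 ⟨Finset.mem_univ b, hYX b (Sym2.mem_mk_right a b)⟩⟩

variable [Fintype V]

/-- Outside an exceptional set `Q`, neither `X` nor `Y` has a common neighbour off both tuples, and
`Y` repeats the adjacencies of `X` on the pairs of indices not mapped into `X` by `Y`. -/
def Coincides (X Y : Fin k ↪ V) (Q : Finset V) (f : Sym2 V → Bool) : Prop :=
  (∀ z ∈ (Finset.univ.map X ∪ Finset.univ.map Y ∪ Q)ᶜ,
    ¬ HasTrace (fun _ => true) (Finset.univ.map X) z f ∧
      ¬ HasTrace (fun _ => true) (Finset.univ.map Y) z f) ∧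
  ∀ p ∈ pairsLeaving (Finset.univ.filter fun a => Y a ∈ Finset.univ.map X),
    f (Sym2.map Y p) = f (Sym2.map X p)

theorem expect_ind_coincides (X Y : Fin k ↪ V) (Q : Finset V) :
    𝔼 f, ind (Coincides X Y Q f) =
      (1 - 2 * (1 / 2) ^ k + (1 / 2) ^ (Finset.univ.map X ∪ Finset.univ.map Y).card) ^
        (Fintype.card V - (Finset.univ.map X ∪ Finset.univ.map Y ∪ Q).card) *
      (1 / 2) ^ (k.choose 2 -
        (Finset.univ.filter fun a => Y a ∈ Finset.univ.map X).card.choose 2) := by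
  have hR (z : V) := dependsOn_not_hasTrace_and_not_hasTrace (fun _ => true)
    (Finset.univ.map X) (Finset.univ.map Y) z
  simp_rw [Coincides, ind_and (∀ z ∈ _, _)]
  rw [expect_mul_ind_forall_eq (Sym2.map.injective Y.injective).injOn,
    expect_ind_forall_of_dependsOn_star
      (disjoint_compl_right.mono_left Finset.subset_union_left) fun z _ => hR z]
  · simp_rw [expect_ind_not_hasTrace_and_not_hasTrace, Finset.prod_const, Finset.card_compl,
      card_pairsLeaving, Finset.card_map, Finset.card_univ, Fintype.card_fin]
    ring
  · refine dependsOn_ind fun f g hfg => propext (forall₂_congr fun z hz => iff_of_eq (hR z ?_))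
    have hzY : z ∉ Finset.univ.map Y := fun h => Finset.mem_compl.1 hz
      (Finset.mem_union_left _ (Finset.mem_union_right _ h))
    exact fun e he => hfg e (star_subset_compl_map_image hzY _ _ he)
  · exact fun p _ f g hfg => hfg _ (map_notMem_map_pairsLeaving X Y p)

end Coincidence

section Confusion

variable {k : ℕ} {V : Type} {X Y : Fin k ↪ V} {w z : V} {f : Sym2 V → Bool}

theorem forall_graphOf_adj_iff : (∀ i, (graphOf f).Adj z (X i)) ↔
    HasTrace (fun _ => true) (Finset.univ.map X) z f ∧ z ∉ Finset.univ.map X := by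
  simp [graphOf_adj, HasTrace, forall_and, @eq_comm _ z]

theorem IsUniqueCommonNbr.not_hasTrace (h : IsUniqueCommonNbr (graphOf f) X w)
    (hz : z ∉ Finset.univ.map X) (hzw : z ≠ w) :
    ¬ HasTrace (fun _ => true) (Finset.univ.map X) z f :=
  fun htrace => hzw ((h z).1 (forall_graphOf_adj_iff.2 ⟨htrace, hz⟩))

/-- The mark `HasMark` of the tuple `X` does not single out `w`. -/
def IsConfused (X : Fin k ↪ V) (w : V) (f : Sym2 V → Bool) : Prop :=
  ∃ u ≠ w, HasMark (graphOf f) X (graphOf f) u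

theorem SameType.apply_map_eq (h : SameType (graphOf f) X (graphOf f) Y) {p : Sym2 (Fin k)}
    (hp : ¬ p.IsDiag) : f (Sym2.map Y p) = f (Sym2.map X p) := by
  induction p with
  | _ a b =>
    have hadj := (h a b).2
    rw [graphOf_adj, graphOf_adj, and_iff_left (X.injective.ne hp),
      and_iff_left (Y.injective.ne hp)] at hadj
    exact Bool.eq_iff_iff.2 hadj

theorem sum_embedding_prod_le [Fintype V] {g : V → ℝ} (hg : ∀ v, 0 ≤ g v) :
    ∑ Y : Fin k ↪ V, ∏ a, g (Y a) ≤ (∑ v, g v) ^ k := by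
  classical
  rw [Fintype.sum_pow, ← Finset.sum_image (f := fun Y : Fin k → V => ∏ a, g (Y a))
    (DFunLike.coe_injective (F := Fin k ↪ V)).injOn]
  exact Finset.sum_le_sum_of_subset_of_nonneg (Finset.subset_univ _)
    fun Y _ _ => Finset.prod_nonneg fun a _ => hg (Y a)

variable [DecidableEq V]

theorem card_map_union_map (X Y : Fin k ↪ V) :
    (Finset.univ.map X ∪ Finset.univ.map Y).card =
      k + (Finset.univ.filter fun a => Y a ∉ Finset.univ.map X).card := by
  rw [← Finset.union_sdiff_self_eq_union, Finset.card_union_of_disjoint Finset.disjoint_sdiff,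
    Finset.card_map, Finset.card_univ, Fintype.card_fin, Finset.sdiff_eq_filter,
    Finset.filter_map, Finset.card_map]
  rfl

theorem card_filter_mem_map (X Y : Fin k ↪ V) :
    (Finset.univ.filter fun a => Y a ∈ Finset.univ.map X).card =
      k - (Finset.univ.filter fun a => Y a ∉ Finset.univ.map X).card := by
  have h := Finset.card_filter_add_card_filter_not (s := (Finset.univ : Finset (Fin k)))
    fun a => Y a ∈ Finset.univ.map X
  rw [Finset.card_univ, Fintype.card_fin] at h
  omega

variable [Fintype V]

theorem isUniqueCommonNbr_of_isolates (hw : w ∉ Finset.univ.map X)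
    (h : Isolates (Finset.univ.map X) w f) : IsUniqueCommonNbr (graphOf f) X w := by
  refine fun z => ⟨fun hz => ?_, fun hzw => ?_⟩
  · obtain ⟨htrace, hzX⟩ := forall_graphOf_adj_iff.1 hz
    by_contra hzw
    exact h.2 z (by rw [Finset.mem_compl, Finset.mem_insert]; tauto) htrace
  · exact hzw ▸ forall_graphOf_adj_iff.2 ⟨h.1, hw⟩

theorem isPinned_of_isolates (hw : w ∉ Finset.univ.map X) (h : Isolates (Finset.univ.map X) w f)
    (hconf : ¬ IsConfused X w f) : IsPinned k (graphOf f) w := by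
  refine ⟨X, fun y => ⟨fun hy => ?_, fun hyw => ?_⟩⟩
  · by_contra hyw
    exact hconf ⟨y, hyw, hy⟩
  · exact hyw ▸ ⟨X, SameType.refl _ X, isUniqueCommonNbr_of_isolates hw h⟩

theorem exists_coincides_of_isConfused (h : Isolates (Finset.univ.map X) w f)
    (hconf : IsConfused X w f) :
    ∃ Y ∈ Finset.univ.filter (fun Y : Fin k ↪ V => ∃ a, Y a ∉ Finset.univ.map X),
      ∃ u ∈ Finset.univ, Coincides X Y {w, u} f := by
  obtain ⟨u, huw, Y, htype, hu⟩ := hconf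
  lift Y to Fin k ↪ V using fun a b hab => X.injective ((htype a b).1.1 hab)
  refine ⟨Y, Finset.mem_filter.2 ⟨Finset.mem_univ Y, ?_⟩, u, Finset.mem_univ u, fun z hz => ?_,
    fun p hp => htype.apply_map_eq ?_⟩
  · by_contra! hYX
    have himage : Finset.univ.map Y = Finset.univ.map X :=
      Finset.eq_of_subset_of_card_le (fun x hx => by
        obtain ⟨a, -, rfl⟩ := Finset.mem_map.1 hx
        exact hYX a) (by simp)
    obtain ⟨htrace, huX⟩ := forall_graphOf_adj_iff.1 ((hu u).2 rfl)
    rw [himage] at htrace huX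
    exact h.2 u (by rw [Finset.mem_compl, Finset.mem_insert]; tauto) htrace
  · simp only [Finset.mem_compl, Finset.mem_union, Finset.mem_insert, Finset.mem_singleton,
      not_or] at hz
    obtain ⟨⟨hzX, hzY⟩, hzw, hzu⟩ := hz
    exact ⟨h.2 z (by rw [Finset.mem_compl, Finset.mem_insert]; tauto), hu.not_hasTrace hzY hzu⟩
  · induction p with
    | _ a b => exact (mem_pairsLeaving.1 hp).1

theorem expect_ind_coincides_le (X Y : Fin k ↪ V) {Q : Finset V} (hQ : Q.card ≤ 2) {j : ℕ}
    (hj : (Finset.univ.filter fun a => Y a ∉ Finset.univ.map X).card = j) :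
    𝔼 f, ind (Coincides X Y Q f) ≤ (1 / 2) ^ (k.choose 2 - (k - j).choose 2) *
      (1 - 2 * (1 / 2) ^ k + (1 / 2) ^ (k + j)) ^ (Fintype.card V - (2 * k + 2)) := by
  have hjk : j ≤ k := hj ▸ (Finset.card_le_univ _).trans_eq (Fintype.card_fin k)
  have hcard : (Finset.univ.map X ∪ Finset.univ.map Y ∪ Q).card ≤ 2 * k + 2 := by
    refine (Finset.card_union_le _ _).trans ?_
    rw [card_map_union_map, hj]
    omega
  have hlower : (1 / 2 : ℝ) ^ k * (1 / 2) ^ k ≤ (1 / 2) ^ (k + j) := by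
    rw [← pow_add]
    exact pow_le_pow_of_le_one (by norm_num) (by norm_num) (by omega)
  have hupper : (1 / 2 : ℝ) ^ (k + j) ≤ (1 / 2) ^ k :=
    pow_le_pow_of_le_one (by norm_num) (by norm_num) (by omega)
  rw [expect_ind_coincides, card_map_union_map, card_filter_mem_map, hj, mul_comm]
  refine mul_le_mul_of_nonneg_left (pow_le_pow_of_le_one ?_ ?_ (by omega)) (by positivity)
  · nlinarith [sq_nonneg (1 - (1 / 2 : ℝ) ^ k)]
  · linarith [show (0 : ℝ) ≤ (1 / 2) ^ k by positivity]

theorem sum_inv_card_pow_le (X : Fin k ↪ V) :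
    ∑ Y : Fin k ↪ V, (Fintype.card V : ℝ)⁻¹ ^
      (Finset.univ.filter fun a => Y a ∉ Finset.univ.map X).card ≤ (k + 1) ^ k := by
  let weight (v : V) : ℝ := if v ∈ Finset.univ.map X then 1 else (Fintype.card V : ℝ)⁻¹
  have hnonneg (v : V) : 0 ≤ weight v := by unfold weight; split_ifs <;> positivity
  have hsum : ∑ v, weight v ≤ k + 1 := by
    calc ∑ v, weight v
        ≤ ∑ v, ((if v ∈ Finset.univ.map X then 1 else 0) + (Fintype.card V : ℝ)⁻¹) := by
          refine Finset.sum_le_sum fun v _ => ?_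
          unfold weight
          split_ifs <;> simp
      _ = k + Fintype.card V * (Fintype.card V : ℝ)⁻¹ := by
          rw [Finset.sum_add_distrib, Finset.sum_const, Finset.card_univ, nsmul_eq_mul]
          simp only [Finset.sum_boole, Finset.filter_univ_mem, Finset.card_map, Finset.card_univ,
            Fintype.card_fin]
      _ ≤ k + 1 := by gcongr; exact mul_inv_le_one
  calc ∑ Y : Fin k ↪ V, (Fintype.card V : ℝ)⁻¹ ^
        (Finset.univ.filter fun a => Y a ∉ Finset.univ.map X).card
      = ∑ Y : Fin k ↪ V, ∏ a, weight (Y a) := by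
        simp only [weight, Finset.prod_ite, Finset.prod_const, one_pow, one_mul]
    _ ≤ (∑ v, weight v) ^ k := sum_embedding_prod_le hnonneg
    _ ≤ (k + 1) ^ k := pow_le_pow_left₀ (Finset.sum_nonneg fun v _ => hnonneg v) hsum k

theorem expect_ind_isolates_and_isConfused_le (X : Fin k ↪ V) (w : V) {h : ℝ} (hh₀ : 0 ≤ h)
    (hh : ∀ j, 1 ≤ j → j ≤ k → (1 / 2) ^ (k.choose 2 - (k - j).choose 2) *
      (1 - 2 * (1 / 2) ^ k + (1 / 2) ^ (k + j)) ^ (Fintype.card V - (2 * k + 2)) ≤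
        h * (Fintype.card V : ℝ)⁻¹ ^ j) :
    𝔼 f, ind (Isolates (Finset.univ.map X) w f ∧ IsConfused X w f) ≤
      Fintype.card V * (h * (k + 1) ^ k) := by
  let outside (Y : Fin k ↪ V) : Finset (Fin k) :=
    Finset.univ.filter fun a => Y a ∉ Finset.univ.map X
  let moved : Finset (Fin k ↪ V) := Finset.univ.filter fun Y => ∃ a, Y a ∉ Finset.univ.map X
  have hmoved : ∀ Y ∈ moved, ∀ u, 𝔼 f, ind (Coincides X Y {w, u} f) ≤
      h * (Fintype.card V : ℝ)⁻¹ ^ (outside Y).card := by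
    intro Y hY u
    obtain ⟨a, ha⟩ := (Finset.mem_filter.1 hY).2
    exact (expect_ind_coincides_le X Y Finset.card_le_two rfl).trans <| hh _
      (Finset.card_pos.2 ⟨a, Finset.mem_filter.2 ⟨Finset.mem_univ a, ha⟩⟩)
      ((Finset.card_le_univ _).trans_eq (Fintype.card_fin k))
  calc 𝔼 f, ind (Isolates (Finset.univ.map X) w f ∧ IsConfused X w f)
      ≤ 𝔼 f, ∑ Y ∈ moved, ∑ u, ind (Coincides X Y {w, u} f) :=
        Finset.expect_le_expect fun f _ =>
          (ind_mono fun hf => exists_coincides_of_isConfused hf.1 hf.2).trans <|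
            (ind_exists_le _ _).trans (Finset.sum_le_sum fun Y _ => ind_exists_le _ _)
    _ = ∑ Y ∈ moved, ∑ u, 𝔼 f, ind (Coincides X Y {w, u} f) := by
        simp_rw [Finset.expect_sum_comm]
    _ ≤ ∑ Y ∈ moved, ∑ _u : V, h * (Fintype.card V : ℝ)⁻¹ ^ (outside Y).card :=
        Finset.sum_le_sum fun Y hY => Finset.sum_le_sum fun u _ => hmoved Y hY u
    _ ≤ ∑ Y, ∑ _u : V, h * (Fintype.card V : ℝ)⁻¹ ^ (outside Y).card :=
        Finset.sum_le_sum_of_subset_of_nonneg (Finset.subset_univ _)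
          fun Y _ _ => Finset.sum_nonneg fun u _ => by positivity
    _ = Fintype.card V * (h * ∑ Y, (Fintype.card V : ℝ)⁻¹ ^ (outside Y).card) := by
        simp only [Finset.sum_const, Finset.card_univ, nsmul_eq_mul, ← Finset.mul_sum]
    _ ≤ Fintype.card V * (h * (k + 1) ^ k) := by gcongr; exact sum_inv_card_pow_le X

end Confusion

section Candidates

/-- The probability that, in the random graph on `n` vertices, a given vertex is isolated (in the
sense of `Isolates`) by a given set of `k` vertices. -/
noncomputable def isolationProb (n k : ℕ) : ℝ :=
  (1 / 2) ^ k * (1 - (1 / 2) ^ k) ^ (n - (k + 1))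

variable {k N : ℕ}

theorem sum_pow_card_agree (σ : Fin k → Fin N) (B : ℝ) :
    ∑ τ : Fin k → Fin N, B ^ (Finset.univ.filter fun i => σ i = τ i).card = (N - 1 + B) ^ k := by
  have hcoord (i : Fin k) : ∑ x : Fin N, (if σ i = x then B else 1) = N - 1 + B := by
    have hsplit (x : Fin N) : (if σ i = x then B else 1) = 1 + if σ i = x then B - 1 else 0 := by
      split_ifs <;> ring
    simp only [hsplit, Finset.sum_add_distrib, Finset.sum_ite_eq, Finset.mem_univ, if_true,
      Finset.sum_const, Finset.card_univ, Fintype.card_fin, nsmul_eq_mul]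
    ring
  calc ∑ τ : Fin k → Fin N, B ^ (Finset.univ.filter fun i => σ i = τ i).card
      = ∑ τ : Fin k → Fin N, ∏ i, (if σ i = τ i then B else 1) := by
        simp only [Finset.prod_ite, Finset.prod_const, one_pow, mul_one]
    _ = ∏ i, ∑ x : Fin N, (if σ i = x then B else 1) := by
        rw [Finset.prod_univ_sum, Fintype.piFinset_univ]
    _ = (N - 1 + B) ^ k := by
        simp only [hcoord, Finset.prod_const, Finset.card_univ, Fintype.card_fin]

variable {V : Type}

/-- Given `k` disjoint blocks of `N` vertices, the tuple taking its `i`-th entry from the `i`-th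
block, at position `σ i`. -/
def candidate (ι : Fin k × Fin N ↪ V) (σ : Fin k → Fin N) : Fin k ↪ V :=
  ⟨fun i => ι (i, σ i), fun _ _ h => congrArg Prod.fst (ι.injective h)⟩

theorem candidate_mem_map_iff {ι : Fin k × Fin N ↪ V} {σ τ : Fin k → Fin N} {i : Fin k} :
    candidate ι τ i ∈ Finset.univ.map (candidate ι σ) ↔ σ i = τ i := by
  simp only [Finset.mem_map, Finset.mem_univ, true_and]
  refine ⟨fun ⟨j, hj⟩ => ?_, fun h => ⟨i, congrArg (fun x => ι (i, x)) h⟩⟩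
  have hpair : (j, σ j) = (i, τ i) := ι.injective hj
  obtain ⟨rfl, hστ⟩ := Prod.mk.inj hpair
  exact hστ

theorem notMem_map_candidate {ι : Fin k × Fin N ↪ V} {w : V} (hw : w ∉ Set.range ι)
    (σ : Fin k → Fin N) : w ∉ Finset.univ.map (candidate ι σ) := by
  rintro h
  obtain ⟨i, -, hi⟩ := Finset.mem_map.1 h
  exact hw ⟨_, hi⟩

variable [DecidableEq V]

theorem card_map_candidate_union (ι : Fin k × Fin N ↪ V) (σ τ : Fin k → Fin N) :
    (Finset.univ.map (candidate ι σ) ∪ Finset.univ.map (candidate ι τ)).card =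
      2 * k - (Finset.univ.filter fun i => σ i = τ i).card := by
  have hcard := Finset.card_filter_add_card_filter_not (s := (Finset.univ : Finset (Fin k)))
    fun i => σ i = τ i
  rw [Finset.card_univ, Fintype.card_fin] at hcard
  rw [card_map_union_map]
  simp only [candidate_mem_map_iff]
  omega

variable [Fintype V]

theorem expect_sum_isolates {ι : Fin k × Fin N ↪ V} {w : V} (hw : w ∉ Set.range ι) :
    𝔼 f, ∑ σ, ind (Isolates (Finset.univ.map (candidate ι σ)) w f) =
      N ^ k * isolationProb (Fintype.card V) k := by
  simp_rw [Finset.expect_sum_comm, expect_ind_isolates (notMem_map_candidate hw _),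
    Finset.card_map, Finset.sum_const, Finset.card_univ, Fintype.card_pi_const, Fintype.card_fin,
    nsmul_eq_mul, Nat.cast_pow, isolationProb]

theorem expect_sum_isolates_sq_le {ι : Fin k × Fin N ↪ V} {w : V} (hw : w ∉ Set.range ι) {A B : ℝ}
    (hAB : ∀ s ≤ k, (1 / 2 : ℝ) ^ (2 * k - s) * (1 - 2 * (1 / 2) ^ k + (1 / 2) ^ (2 * k - s)) ^
      (Fintype.card V - (2 * k - s + 1)) ≤ isolationProb (Fintype.card V) k ^ 2 * (A * B ^ s)) :
    𝔼 f, (∑ σ, ind (Isolates (Finset.univ.map (candidate ι σ)) w f)) ^ 2 ≤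
      N ^ k * (isolationProb (Fintype.card V) k ^ 2 * (A * (N - 1 + B) ^ k)) := by
  have hpair (σ τ : Fin k → Fin N) :
      𝔼 f, ind (Isolates (Finset.univ.map (candidate ι σ)) w f) *
        ind (Isolates (Finset.univ.map (candidate ι τ)) w f) ≤
      isolationProb (Fintype.card V) k ^ 2 *
        (A * B ^ (Finset.univ.filter fun i => σ i = τ i).card) := by
    refine (expect_ind_isolates_mul_le (notMem_map_candidate hw σ)
      (notMem_map_candidate hw τ)).trans ?_
    rw [card_map_candidate_union, Finset.card_map, Finset.card_map, Finset.card_univ,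
      Fintype.card_fin, sub_sub (1 : ℝ), ← two_mul]
    exact hAB _ ((Finset.card_le_univ _).trans_eq (Fintype.card_fin k))
  simp_rw [pow_two (∑ _, _), Finset.sum_mul_sum, Finset.expect_sum_comm]
  refine (Finset.sum_le_sum fun _ _ => Finset.sum_le_sum fun _ _ => hpair _ _).trans_eq ?_
  simp_rw [← Finset.mul_sum, sum_pow_card_agree, Finset.sum_const, Finset.card_univ,
    Fintype.card_pi_const, Fintype.card_fin, nsmul_eq_mul, Nat.cast_pow]
  ring

theorem ind_not_isPinned_le {ι : Fin k × Fin N ↪ V} {w : V} (hw : w ∉ Set.range ι) (a : ℝ)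
    (f : Sym2 V → Bool) :
    ind (¬ IsPinned k (graphOf f) w) ≤
      ind (∑ σ, ind (Isolates (Finset.univ.map (candidate ι σ)) w f) ≤ a) +
      ind (a ≤ ∑ σ, ind (Isolates (Finset.univ.map (candidate ι σ)) w f ∧
        IsConfused (candidate ι σ) w f)) := by
  have hconf (hpin : ¬ IsPinned k (graphOf f) w) :
      ∑ σ, ind (Isolates (Finset.univ.map (candidate ι σ)) w f) ≤
        ∑ σ, ind (Isolates (Finset.univ.map (candidate ι σ)) w f ∧
          IsConfused (candidate ι σ) w f) :=
    Finset.sum_le_sum fun σ _ => ind_mono fun hiso => ⟨hiso, by_contra fun hc =>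
      hpin (isPinned_of_isolates (notMem_map_candidate hw σ) hiso hc)⟩
  refine (ind_mono fun hpin => ?_).trans (ind_or_le _ _)
  exact (le_total _ a).imp_right fun h => h.trans (hconf hpin)

theorem expect_ind_not_isPinned_le (hN : 0 < N) {ι : Fin k × Fin N ↪ V} {w : V}
    (hw : w ∉ Set.range ι) (hp : 0 < isolationProb (Fintype.card V) k) {A B c : ℝ}
    (hAB : ∀ s ≤ k, (1 / 2 : ℝ) ^ (2 * k - s) * (1 - 2 * (1 / 2) ^ k + (1 / 2) ^ (2 * k - s)) ^
      (Fintype.card V - (2 * k - s + 1)) ≤ isolationProb (Fintype.card V) k ^ 2 * (A * B ^ s))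
    (hc : ∀ X : Fin k ↪ V,
      𝔼 f, ind (Isolates (Finset.univ.map X) w f ∧ IsConfused X w f) ≤ c) :
    𝔼 f, ind (¬ IsPinned k (graphOf f) w) ≤
      4 * (A * ((N - 1 + B) / N) ^ k - 1) + 2 * (c / isolationProb (Fintype.card V) k) := by
  have hmean := expect_sum_isolates hw
  have hsq := expect_sum_isolates_sq_le hw hAB
  set p := isolationProb (Fintype.card V) k
  let isolating (f : Sym2 V → Bool) : ℝ :=
    ∑ σ, ind (Isolates (Finset.univ.map (candidate ι σ)) w f)
  let confused (f : Sym2 V → Bool) : ℝ :=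
    ∑ σ, ind (Isolates (Finset.univ.map (candidate ι σ)) w f ∧ IsConfused (candidate ι σ) w f)
  change 𝔼 f, isolating f = N ^ k * p at hmean
  change 𝔼 f, isolating f ^ 2 ≤ _ at hsq
  have hconfused : 𝔼 f, confused f ≤ N ^ k * c := by
    simp_rw [confused, Finset.expect_sum_comm]
    refine (Finset.sum_le_sum fun σ _ => hc (candidate ι σ)).trans_eq ?_
    rw [Finset.sum_const, Finset.card_univ, Fintype.card_pi_const, Fintype.card_fin, nsmul_eq_mul,
      Nat.cast_pow]
  have hpos : 0 < 𝔼 f, isolating f := by rw [hmean]; positivity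
  calc 𝔼 f, ind (¬ IsPinned k (graphOf f) w)
      ≤ 𝔼 f, (ind (isolating f ≤ (𝔼 f, isolating f) / 2) +
          ind ((𝔼 f, isolating f) / 2 ≤ confused f)) :=
        Finset.expect_le_expect fun f _ => ind_not_isPinned_le hw _ f
    _ ≤ 4 * ((𝔼 f, isolating f ^ 2) / (𝔼 f, isolating f) ^ 2 - 1) +
          (𝔼 f, confused f) / ((𝔼 f, isolating f) / 2) := by
        rw [Finset.expect_add_distrib]
        exact add_le_add (expect_ind_le_half_of_chebyshev hpos) (expect_ind_le_of_markov
          (fun f => Finset.sum_nonneg fun σ _ => ind_nonneg _) (half_pos hpos))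
    _ ≤ 4 * (N ^ k * (p ^ 2 * (A * (N - 1 + B) ^ k)) / (N ^ k * p) ^ 2 - 1) +
          N ^ k * c / (N ^ k * p / 2) := by
        rw [hmean] at hpos ⊢
        gcongr
    _ = 4 * (A * ((N - 1 + B) / N) ^ k - 1) + 2 * (c / p) := by
        rw [div_pow]
        field_simp

end Candidates

section Separation

variable {V : Type} [Fintype V] {G : SimpleGraph V} {m : ℕ}

open Classical in
theorem HasExtension.two_pow_le_card_separating (hext : HasExtension (m + 2) G)
    (hV : m + 2 ≤ Fintype.card V) {u v : V} (huv : u ≠ v) :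
    2 ^ m ≤ (Finset.univ.filter fun w => ¬ (G.Adj u w ↔ G.Adj v w)).card := by
  obtain ⟨S, hS, hcard⟩ := Finset.exists_subset_card_eq (s := ({u, v} : Finset V)ᶜ) (n := m)
    (by rw [Finset.card_compl, Finset.card_pair huv]; omega)
  have huS : u ∉ S := fun h => by simpa using hS h
  have hvS : v ∉ S := fun h => by simpa using hS h
  have hsize : (insert u (insert v S)).card ≤ m + 2 := by
    rw [Finset.card_insert_of_notMem (by simp [huv, huS]), Finset.card_insert_of_notMem hvS, hcard]
  choose z _ hz using fun T : Finset V => hext (insert u (insert v S)) (insert u T) hsize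
  have hzS (T : Finset V) : ∀ x ∈ S, G.Adj (z T) x ↔ x ∈ T := fun x hx => by
    rw [hz T x (by simp [hx]), Finset.mem_insert, or_iff_right fun h : x = u => huS (h ▸ hx)]
  have hinj : Set.InjOn z S.powerset := by
    intro T hT T' hT' h
    rw [Finset.mem_coe, Finset.mem_powerset] at hT hT'
    ext x
    by_cases hx : x ∈ S
    · rw [← hzS T x hx, h, hzS T' x hx]
    · exact iff_of_false (fun h => hx (hT h)) fun h => hx (hT' h)
  rw [← hcard, ← Finset.card_powerset]
  refine Finset.card_le_card_of_injOn z (fun T hT => ?_) hinj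
  have hzu : G.Adj u (z T) := ((hz T u (by simp)).2 (by simp)).symm
  have hzv : ¬ G.Adj v (z T) := fun h => by
    have hvT := (hz T v (by simp)).1 h.symm
    exact hvS (Finset.mem_powerset.1 hT ((Finset.mem_insert.1 hvT).resolve_left huv.symm))
  simp [hzu, hzv]

theorem HasExtension.exists_isPinned_separating {k : ℕ} (hext : HasExtension (m + 2) G)
    (hV : m + 2 ≤ Fintype.card V) (hfew : ∑ w, ind (¬ IsPinned k G w) < 2 ^ m) {u v : V}
    (huv : u ≠ v) : ∃ w, IsPinned k G w ∧ ¬ (G.Adj u w ↔ G.Adj v w) := by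
  classical
  rw [sum_ind_eq_card] at hfew
  by_contra! hno
  refine (hext.two_pow_le_card_separating hV huv).not_gt ((Finset.card_le_card ?_).trans_lt
    (by exact_mod_cast hfew))
  exact Finset.monotone_filter_right _ fun w _ hw hpin => hw (hno w hpin)

end Separation

section Estimates

variable {k : ℕ}

/-- The number of vertices for which the expected number of common neighbours of `k` vertices is
about `k ^ 2 / 2`. -/
def vertexCount (k : ℕ) : ℕ := k ^ 2 * 2 ^ (k - 1)

theorem two_mul_vertexCount (hk : 1 ≤ k) : 2 * vertexCount k = k ^ 2 * 2 ^ k := by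
  rw [vertexCount, mul_left_comm, mul_pow_sub_one (by lia)]

theorem vertexCount_eq (hk : 1 ≤ k) : (vertexCount k : ℝ) = k ^ 2 / 2 * 2 ^ k := by
  have := two_mul_vertexCount hk
  rify at this
  linarith

theorem vertexCount_mul_half_pow (hk : 1 ≤ k) : (vertexCount k : ℝ) * (1 / 2) ^ k = k ^ 2 / 2 := by
  rw [vertexCount_eq hk, mul_assoc, ← mul_pow]
  norm_num

theorem vertexCount_lt_vertexCount {l : ℕ} (hk : 1 ≤ k) (h : k < l) :
    vertexCount k < vertexCount l := by
  unfold vertexCount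
  gcongr
  norm_num

theorem two_mul_add_two_le_vertexCount (hk : 4 ≤ k) : 2 * k + 2 ≤ vertexCount k := by
  have : 1 ≤ 2 ^ (k - 1) := Nat.one_le_two_pow
  unfold vertexCount
  nlinarith

theorem sq_le_two_pow (hk : 4 ≤ k) : k ^ 2 ≤ 2 ^ k := by
  induction k, hk using Nat.le_induction with
  | base => norm_num
  | succ k hk ih =>
    rw [pow_succ 2]
    nlinarith

theorem sq_mul_half_pow_le (hk : 4 ≤ k) : (k : ℝ) ^ 2 * (1 / 2) ^ k ≤ 1 := by
  rw [one_div, inv_pow, ← div_eq_mul_inv]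
  exact div_le_one_of_le₀ (by exact_mod_cast sq_le_two_pow hk) (by positivity)

theorem half_pow_le (hk : 4 ≤ k) : (1 / 2 : ℝ) ^ k ≤ 1 / 16 :=
  (pow_le_pow_of_le_one (by norm_num) (by norm_num) hk).trans (by norm_num)

theorem exp_neg_le_one_sub {q : ℝ} (hq : q ≤ 1 / 2) : Real.exp (-(q + 2 * q ^ 2)) ≤ 1 - q := by
  have h₀ : 0 < 1 - q := by linarith
  rw [← Real.le_log_iff_exp_le h₀]
  have hinv : (1 - q)⁻¹ ≤ 1 + q + 2 * q ^ 2 := by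
    rw [inv_le_iff_one_le_mul₀ h₀]
    nlinarith [mul_nonneg (sq_nonneg q) (by linarith : 0 ≤ 1 - 2 * q)]
  linarith [Real.one_sub_inv_le_log_of_pos h₀]

theorem one_le_one_sub_pow_mul_exp {q : ℝ} (hq₀ : 0 ≤ q) (hq : q ≤ 1 / 2) (m : ℕ) :
    1 ≤ (1 - q) ^ m * Real.exp (m * (2 * q)) := by
  have hexp : Real.exp (-(2 * q)) ≤ 1 - q :=
    (Real.exp_le_exp.2 (by nlinarith)).trans (exp_neg_le_one_sub hq)
  calc (1 : ℝ) = Real.exp (-(2 * q)) ^ m * Real.exp (m * (2 * q)) := by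
        rw [← Real.exp_nat_mul, ← Real.exp_add, mul_neg, neg_add_cancel, Real.exp_zero]
    _ ≤ _ := by gcongr

theorem one_sub_two_mul_add_le {q x : ℝ} (hq : q ≤ 1 / 16) (hx : 0 ≤ x) :
    1 - 2 * q + x ≤ (1 - q) ^ 2 * Real.exp (5 / 4 * x) := by
  have hsq : 1 ≤ 5 / 4 * (1 - q) ^ 2 := by nlinarith
  calc 1 - 2 * q + x ≤ (1 - q) ^ 2 * (5 / 4 * x + 1) := by
        linarith [mul_le_mul_of_nonneg_right hsq hx, sq_nonneg q]
    _ ≤ _ := by gcongr; exact Real.add_one_le_exp _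

theorem one_sub_two_mul_add_pow_le {q x : ℝ} (hq₀ : 0 ≤ q) (hq : q ≤ 1 / 16) (hx : 0 ≤ x)
    (m l : ℕ) :
    (1 - 2 * q + x) ^ m ≤ (1 - q) ^ (2 * m + l) * Real.exp (m * (5 / 4 * x) + l * (2 * q)) := by
  have hbase : 0 ≤ 1 - 2 * q + x := by linarith
  calc (1 - 2 * q + x) ^ m ≤ ((1 - q) ^ 2 * Real.exp (5 / 4 * x)) ^ m := by
        gcongr
        exact one_sub_two_mul_add_le hq hx
    _ ≤ ((1 - q) ^ 2 * Real.exp (5 / 4 * x)) ^ m * ((1 - q) ^ l * Real.exp (l * (2 * q))) :=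
        le_mul_of_one_le_right (by positivity) (one_le_one_sub_pow_mul_exp hq₀ (by linarith) l)
    _ = _ := by
        rw [pow_add, pow_mul (1 - q) 2 m, Real.exp_add, Real.exp_nat_mul _ m, mul_pow]
        ring

theorem one_sub_half_pow_pow_le (l m : ℕ) :
    (1 - (1 / 2 : ℝ) ^ l) ^ m ≤ Real.exp (-(m * (1 / 2) ^ l)) := by
  rw [← mul_neg, Real.exp_nat_mul]
  exact pow_le_pow_left₀ (one_sub_half_pow_nonneg l) (Real.one_sub_le_exp_neg _) m

theorem half_pow_mul_exp_le_isolationProb (hk : 4 ≤ k) :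
    (1 / 2) ^ k * Real.exp (-(k ^ 2 / 2) - 1) ≤ isolationProb (vertexCount k) k := by
  have hq := half_pow_le hk
  have hkq := sq_mul_half_pow_le hk
  have hnq := vertexCount_mul_half_pow (by lia : 1 ≤ k)
  have hq₀ : (0 : ℝ) < (1 / 2) ^ k := by positivity
  unfold isolationProb
  gcongr
  set q : ℝ := (1 / 2) ^ k
  calc Real.exp (-(k ^ 2 / 2) - 1) ≤ Real.exp (vertexCount k * -(q + 2 * q ^ 2)) := by
        rw [Real.exp_le_exp]
        linear_combination (1 + 2 * q) * hnq + hkq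
    _ = Real.exp (-(q + 2 * q ^ 2)) ^ vertexCount k := Real.exp_nat_mul _ _
    _ ≤ (1 - q) ^ vertexCount k := by gcongr; exact exp_neg_le_one_sub (by linarith)
    _ ≤ _ := pow_le_pow_of_le_one (by linarith) (by linarith) (Nat.sub_le _ _)

theorem isolationProb_pos (hk : 4 ≤ k) : 0 < isolationProb (vertexCount k) k :=
  lt_of_lt_of_le (by positivity) (half_pow_mul_exp_le_isolationProb hk)

section SecondMoment

variable {s : ℕ}

theorem two_pow_mul_le (hs : s ≤ k) : 2 ^ s * k ≤ k + s * 2 ^ k := by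
  induction k, hs using Nat.le_induction with
  | base => lia
  | succ k hk ih =>
    rcases Nat.eq_zero_or_pos s with rfl | hs
    · simp
    have : 2 ^ s ≤ s * 2 ^ k :=
      (Nat.pow_le_pow_right two_pos hk).trans (Nat.le_mul_of_pos_left _ hs)
    rw [pow_succ]
    linarith

theorem half_pow_mul_two_pow_mul_le (hs : s ≤ k) :
    k * ((1 / 2 : ℝ) ^ k * 2 ^ s) ≤ k * (1 / 2) ^ k + s := by
  have h : (2 : ℝ) ^ s * k ≤ k + s * 2 ^ k := by exact_mod_cast two_pow_mul_le hs
  calc k * ((1 / 2 : ℝ) ^ k * 2 ^ s) = (1 / 2) ^ k * (2 ^ s * k) := by ring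
    _ ≤ (1 / 2) ^ k * (k + s * 2 ^ k) := by gcongr
    _ = k * (1 / 2) ^ k + s * (1 / 2 * 2) ^ k := by rw [mul_pow]; ring
    _ = _ := by norm_num

theorem half_pow_two_mul_sub (hs : s ≤ k) :
    (1 / 2 : ℝ) ^ (2 * k - s) = ((1 / 2) ^ k) ^ 2 * 2 ^ s := by
  rw [← pow_mul, mul_comm k, pow_sub₀ _ (by norm_num) (by lia)]
  simp

theorem vertexCount_mul_half_pow_sq_le (hs : s ≤ k) (hk : 1 ≤ k) :
    (vertexCount k : ℝ) * (5 / 4 * (((1 / 2) ^ k) ^ 2 * 2 ^ s)) ≤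
      5 / 8 * k ^ 2 * (1 / 2) ^ k + 5 / 8 * k * s :=
  calc (vertexCount k : ℝ) * (5 / 4 * (((1 / 2) ^ k) ^ 2 * 2 ^ s))
      = 5 / 4 * (vertexCount k * (1 / 2) ^ k) * ((1 / 2) ^ k * 2 ^ s) := by ring
    _ = 5 / 8 * k * (k * ((1 / 2) ^ k * 2 ^ s)) := by rw [vertexCount_mul_half_pow hk]; ring
    _ ≤ 5 / 8 * k * (k * (1 / 2) ^ k + s) := by gcongr; exact half_pow_mul_two_pow_mul_le hs
    _ = _ := by ring

/-- The correlation of the isolation of a vertex by two `k`-tuples with `s` common entries is at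
most `exp (overlapExponent k) * (2 * exp (5 / 8 * k)) ^ s`. -/
noncomputable def overlapExponent (k : ℕ) : ℝ :=
  4 * k * (1 / 2) ^ k + 5 / 8 * k ^ 2 * (1 / 2) ^ k

theorem half_pow_mul_pow_le_isolationProb_sq_mul (hk : 4 ≤ k) (hs : s ≤ k) :
    (1 / 2 : ℝ) ^ (2 * k - s) * (1 - 2 * (1 / 2) ^ k + (1 / 2) ^ (2 * k - s)) ^
      (vertexCount k - (2 * k - s + 1)) ≤
    isolationProb (vertexCount k) k ^ 2 *
      (Real.exp (overlapExponent k) * (2 * Real.exp (5 / 8 * k)) ^ s) := by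
  have hn := two_mul_add_two_le_vertexCount hk
  have hq := half_pow_le hk
  have hx := vertexCount_mul_half_pow_sq_le hs (by lia)
  rw [half_pow_two_mul_sub hs, isolationProb, overlapExponent]
  set q : ℝ := (1 / 2) ^ k
  set n := vertexCount k
  set m := n - (2 * k - s + 1) with hm
  have hexp : m * (5 / 4 * (q ^ 2 * 2 ^ s)) + (2 * (k - s) : ℕ) * (2 * q) ≤
      4 * k * q + 5 / 8 * k ^ 2 * q + s * (5 / 8 * k) := by
    have hmn : (m : ℝ) * (5 / 4 * (q ^ 2 * 2 ^ s)) ≤ n * (5 / 4 * (q ^ 2 * 2 ^ s)) := by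
      gcongr
      exact_mod_cast Nat.sub_le _ _
    have hks : ((2 * (k - s) : ℕ) : ℝ) * (2 * q) ≤ (2 * k : ℕ) * (2 * q) := by
      gcongr
      exact Nat.sub_le _ _
    push_cast at hks ⊢
    linarith
  calc q ^ 2 * 2 ^ s * (1 - 2 * q + q ^ 2 * 2 ^ s) ^ m
      ≤ q ^ 2 * 2 ^ s * ((1 - q) ^ (2 * m + 2 * (k - s)) *
          Real.exp (m * (5 / 4 * (q ^ 2 * 2 ^ s)) + (2 * (k - s) : ℕ) * (2 * q))) := by
        gcongr
        exact one_sub_two_mul_add_pow_le (by positivity) hq (by positivity) _ _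
    _ ≤ q ^ 2 * 2 ^ s * ((1 - q) ^ (2 * m + 2 * (k - s)) *
          Real.exp (4 * k * q + 5 / 8 * k ^ 2 * q + s * (5 / 8 * k))) := by
        have : 0 ≤ 1 - q := by linarith
        gcongr
    _ = _ := by
        rw [show 2 * m + 2 * (k - s) = (n - (k + 1)) * 2 by rw [hm]; lia, pow_mul, Real.exp_add,
          Real.exp_nat_mul, mul_pow q, mul_pow 2]
        ring

end SecondMoment

section Coincidence

variable {j : ℕ}

theorem choose_two_sub_choose_two (hj : j ≤ k) :
    k.choose 2 - (k - j).choose 2 + j.choose 2 + j = k * j := by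
  obtain ⟨i, rfl⟩ := Nat.exists_eq_add_of_le' hj
  have hchoose (a : ℕ) : a.choose 2 * 2 + a = a * a := by
    induction a with
    | zero => rfl
    | succ a ih => rw [Nat.choose_succ_succ', Nat.choose_one_right]; linarith
  have hle : i.choose 2 ≤ (i + j).choose 2 := Nat.choose_le_choose 2 (Nat.le_add_right i j)
  rw [Nat.add_sub_cancel]
  zify [hle] at hchoose ⊢
  have hsum := hchoose (i + j)
  push_cast at hsum
  linarith [hchoose i, hchoose j]

theorem choose_two_mul_log_two_le (hk : 4 ≤ k) (hj : 1 ≤ j) (hjk : j ≤ k) :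
    (j.choose 2 : ℝ) * Real.log 2 ≤ k ^ 2 * (7 / 16 - (1 / 2) ^ j / 2) := by
  have hlog := Real.log_two_lt_d9
  have hlog₀ : 0 < Real.log 2 := Real.log_pos (by norm_num)
  have hk' : (4 : ℝ) ≤ k := by exact_mod_cast hk
  have hjk' : (j : ℝ) ≤ k := by exact_mod_cast hjk
  rw [Nat.cast_choose_two]
  rcases (by lia : j = 1 ∨ j = 2 ∨ j = 3 ∨ 4 ≤ j) with rfl | rfl | rfl | h4
  · norm_num
  · norm_num; nlinarith
  · norm_num; nlinarith
  · have hhalf := half_pow_le h4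
    have h4' : (4 : ℝ) ≤ j := by exact_mod_cast h4
    have : (j : ℝ) * (j - 1) / 2 * Real.log 2 ≤ k ^ 2 / 2 * (7 / 10) := by
      gcongr ?_ * ?_ <;> nlinarith
    nlinarith [sq_nonneg (k : ℝ)]

theorem vertexCount_pow_mul_half_pow_le (hj : 1 ≤ j) (hjk : j ≤ k) :
    (vertexCount k : ℝ) ^ j * (1 / 2) ^ (k.choose 2 - (k - j).choose 2) ≤
      k ^ (2 * k) * 2 ^ j.choose 2 := by
  have hexp : (k - 1) * j = j.choose 2 + (k.choose 2 - (k - j).choose 2) := by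
    have := choose_two_sub_choose_two hjk
    rw [Nat.sub_mul]
    lia
  have hk : (1 : ℝ) ≤ k := by exact_mod_cast hj.trans hjk
  calc (vertexCount k : ℝ) ^ j * (1 / 2) ^ (k.choose 2 - (k - j).choose 2)
      = k ^ (2 * j) * 2 ^ j.choose 2 *
          (2 ^ (k.choose 2 - (k - j).choose 2) * (1 / 2) ^ (k.choose 2 - (k - j).choose 2)) := by
        rw [vertexCount, Nat.cast_mul, Nat.cast_pow, Nat.cast_pow, Nat.cast_two, mul_pow, ← pow_mul,
          ← pow_mul, hexp, pow_add]
        ring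
    _ = k ^ (2 * j) * 2 ^ j.choose 2 := by rw [← mul_pow]; norm_num
    _ ≤ _ := by gcongr

theorem one_sub_two_mul_half_pow_add_pow_le (hk : 4 ≤ k) (j : ℕ) :
    (1 - 2 * (1 / 2) ^ k + (1 / 2) ^ (k + j)) ^ (vertexCount k - (2 * k + 2)) ≤
      Real.exp (4 - (2 - (1 / 2) ^ j) * (k ^ 2 / 2)) := by
  have hn := two_mul_add_two_le_vertexCount hk
  have hnq := vertexCount_mul_half_pow (by lia : 1 ≤ k)
  have hq := half_pow_le hk
  have hkq := sq_mul_half_pow_le hk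
  have hk' : (4 : ℝ) ≤ k := by exact_mod_cast hk
  have hq₀ : (0 : ℝ) < (1 / 2) ^ k := by positivity
  have hr₀ : (0 : ℝ) < (1 / 2) ^ j := by positivity
  have hr₁ : (1 / 2 : ℝ) ^ j ≤ 1 := pow_le_one₀ (by norm_num) (by norm_num)
  rw [pow_add (1 / 2 : ℝ) k j]
  set q : ℝ := (1 / 2) ^ k
  set r : ℝ := (1 / 2) ^ j
  calc (1 - 2 * q + q * r) ^ (vertexCount k - (2 * k + 2))
      ≤ Real.exp (-(q * (2 - r))) ^ (vertexCount k - (2 * k + 2)) := by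
        refine pow_le_pow_left₀ (by nlinarith) ?_ _
        linarith [Real.one_sub_le_exp_neg (q * (2 - r))]
    _ ≤ _ := by
        rw [← Real.exp_nat_mul, Real.exp_le_exp, Nat.cast_sub hn, ← hnq]
        push_cast
        have hkq' : q * (2 * k + 2) ≤ 1 := by nlinarith
        have : q * (2 * k + 2) * (2 - r) ≤ 1 * 2 := by gcongr <;> linarith
        linarith

/-- A bound, up to the factor `(vertexCount k)⁻¹ ^ j`, for the probability that a `k`-tuple that
moves `j` entries of a given one still has the same type and a unique common neighbour. -/
noncomputable def coincidenceFactor (k : ℕ) : ℝ :=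
  k ^ (2 * k) * Real.exp (4 - 9 / 16 * k ^ 2)

theorem half_pow_mul_pow_le_coincidenceFactor_mul (hk : 4 ≤ k) (hj : 1 ≤ j) (hjk : j ≤ k) :
    (1 / 2 : ℝ) ^ (k.choose 2 - (k - j).choose 2) *
      (1 - 2 * (1 / 2) ^ k + (1 / 2) ^ (k + j)) ^ (vertexCount k - (2 * k + 2)) ≤
    coincidenceFactor k * (vertexCount k : ℝ)⁻¹ ^ j := by
  have hn : (0 : ℝ) < vertexCount k := by
    exact_mod_cast (Nat.succ_pos _).trans_le (two_mul_add_two_le_vertexCount hk)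
  have hbase : (0 : ℝ) ≤ 1 - 2 * (1 / 2) ^ k + (1 / 2) ^ (k + j) := by
    have : (0 : ℝ) < (1 / 2) ^ (k + j) := by positivity
    linarith [half_pow_le hk]
  rw [inv_pow, ← div_eq_mul_inv, le_div_iff₀ (by positivity)]
  calc _ = (vertexCount k : ℝ) ^ j * (1 / 2) ^ (k.choose 2 - (k - j).choose 2) *
        (1 - 2 * (1 / 2) ^ k + (1 / 2) ^ (k + j)) ^ (vertexCount k - (2 * k + 2)) := by ring
    _ ≤ k ^ (2 * k) * 2 ^ j.choose 2 * Real.exp (4 - (2 - (1 / 2) ^ j) * (k ^ 2 / 2)) := by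
        gcongr ?_ * ?_
        · exact vertexCount_pow_mul_half_pow_le hj hjk
        · exact one_sub_two_mul_half_pow_add_pow_le hk j
    _ = k ^ (2 * k) *
        Real.exp (j.choose 2 * Real.log 2 + (4 - (2 - (1 / 2) ^ j) * (k ^ 2 / 2))) := by
        rw [Real.exp_add, Real.exp_nat_mul, Real.exp_log two_pos, mul_assoc]
    _ ≤ _ := by
        unfold coincidenceFactor
        gcongr
        linarith [choose_two_mul_log_two_le hk hj hjk]

end Coincidence

end Estimates

section Asymptotics

open Filter Topology

variable {k : ℕ}

theorem eventually_log_le {ε : ℝ} (hε : 0 < ε) :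
    ∀ᶠ k : ℕ in atTop, Real.log (k + 1) ≤ ε * (k + 1) := by
  have hcast : Tendsto (fun k : ℕ => (k : ℝ) + 1) atTop atTop :=
    tendsto_atTop_add_const_right _ _ tendsto_natCast_atTop_atTop
  filter_upwards [hcast.eventually (Real.isLittleO_log_id_atTop.bound hε)] with k hk
  rw [id_eq, Real.norm_eq_abs, Real.norm_of_nonneg (by positivity)] at hk
  exact (le_abs_self _).trans hk

theorem tendsto_exp_neg_nat : Tendsto (fun k : ℕ => Real.exp (-(k : ℝ))) atTop (𝓝 0) :=
  Real.tendsto_exp_neg_atTop_nhds_zero.comp tendsto_natCast_atTop_atTop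

section Extension

/-- The probability that the extension property for `k - 1` vertices fails. -/
noncomputable def extensionError (k : ℕ) : ℝ :=
  𝔼 f : Sym2 (Fin (vertexCount k)) → Bool, ind (¬ HasExtension (k - 1) (graphOf f))

theorem two_mul_vertexCount_pow_le (hk : 1 ≤ k) :
    (2 * (vertexCount k : ℝ)) ^ (k - 1) ≤
      Real.exp (2 * k * Real.log (k + 1) + k ^ 2 * Real.log 2) := by
  have hn : 2 * (vertexCount k : ℝ) = k ^ 2 * 2 ^ k := by exact_mod_cast two_mul_vertexCount hk
  have hk' : (1 : ℝ) ≤ k := by exact_mod_cast hk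
  calc (2 * (vertexCount k : ℝ)) ^ (k - 1) ≤ (k ^ 2 * 2 ^ k) ^ k := by
        rw [hn]
        exact pow_le_pow_right₀ (one_le_mul_of_one_le_of_one_le (one_le_pow₀ hk')
          (one_le_pow₀ one_le_two)) (Nat.sub_le _ _)
    _ ≤ ((k + 1) ^ 2 * 2 ^ k) ^ k := by gcongr; linarith
    _ = (k + 1) ^ (2 * k) * 2 ^ (k * k) := by rw [mul_pow, ← pow_mul, ← pow_mul]
    _ = Real.exp ((2 * k : ℕ) * Real.log (k + 1) + (k * k : ℕ) * Real.log 2) := by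
        rw [Real.exp_add, Real.exp_nat_mul, Real.exp_nat_mul, Real.exp_log (by positivity),
          Real.exp_log two_pos]
    _ = _ := by push_cast; ring_nf

theorem one_sub_half_pow_pow_vertexCount_le (hk : 4 ≤ k) :
    (1 - (1 / 2 : ℝ) ^ (k - 1)) ^ (vertexCount k - (k - 1)) ≤ Real.exp (-k ^ 2 + 2) := by
  have hn := two_mul_add_two_le_vertexCount hk
  have hnq := vertexCount_mul_half_pow (by lia : 1 ≤ k)
  have hkq := sq_mul_half_pow_le hk
  have hk' : (4 : ℝ) ≤ k := by exact_mod_cast hk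
  have hpred : (1 / 2 : ℝ) ^ (k - 1) = 2 * (1 / 2) ^ k := by
    rw [← mul_pow_sub_one (by lia : k ≠ 0)]
    ring
  have hq₀ : (0 : ℝ) < (1 / 2) ^ k := by positivity
  refine (one_sub_half_pow_pow_le _ _).trans (Real.exp_le_exp.2 ?_)
  rw [hpred, Nat.cast_sub (by lia), Nat.cast_sub (by lia)]
  push_cast
  nlinarith

theorem extensionError_le (hk : 4 ≤ k) :
    extensionError k ≤ Real.exp (2 * k * Real.log (k + 1) + k ^ 2 * Real.log 2 - k ^ 2 + 2) := by
  have hn := two_mul_add_two_le_vertexCount hk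
  have h := expect_ind_not_hasExtension_le (V := Fin (vertexCount k)) (M := k - 1)
    (by rw [Fintype.card_fin]; lia)
  rw [Fintype.card_fin] at h
  calc extensionError k ≤ _ := h
    _ ≤ Real.exp (2 * k * Real.log (k + 1) + k ^ 2 * Real.log 2) * Real.exp (-k ^ 2 + 2) :=
        mul_le_mul (two_mul_vertexCount_pow_le (by lia)) (one_sub_half_pow_pow_vertexCount_le hk)
          (pow_nonneg (one_sub_half_pow_nonneg _) _) (Real.exp_nonneg _)
    _ = _ := by rw [← Real.exp_add]; ring_nf

theorem tendsto_extensionError : Tendsto extensionError atTop (𝓝 0) := by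
  refine squeeze_zero' (Eventually.of_forall fun k => Finset.expect_nonneg fun f _ => ind_nonneg _)
    ?_ tendsto_exp_neg_nat
  filter_upwards [eventually_ge_atTop 100, eventually_log_le (by norm_num : (0 : ℝ) < 1 / 100)]
    with k hk hlog
  refine (extensionError_le (by lia)).trans (Real.exp_le_exp.2 ?_)
  have hk' : (100 : ℝ) ≤ k := by exact_mod_cast hk
  have hlog2 := Real.log_two_lt_d9
  have hklog : 2 * (k : ℝ) * Real.log (k + 1) ≤ 2 * k * (1 / 100 * (k + 1)) := by gcongr
  have hksq : (k : ℝ) ^ 2 * Real.log 2 ≤ k ^ 2 * (7 / 10) := by gcongr; linarith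
  nlinarith

theorem exists_hasExtension (k : ℕ) :
    ∃ l > k, ∃ H : SimpleGraph (Fin (vertexCount l)), HasExtension (l - 1) H := by
  obtain ⟨l, hlt, hl⟩ := ((tendsto_extensionError.eventually (gt_mem_nhds zero_lt_one)).and
    (eventually_gt_atTop k)).exists
  refine ⟨l, hl, ?_⟩
  by_contra! hnone
  have : extensionError l = 1 := by
    simp_rw [extensionError, ind_of_true (hnone _), Fintype.expect_const]
  linarith

end Extension

section Moment

/-- The second moment of the number of candidate tuples isolating a vertex is at most
`exp (momentExponent k)` times the square of the first. -/
noncomputable def momentExponent (k : ℕ) : ℝ :=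
  overlapExponent k + 2 * k * (Real.exp (5 / 8) / 2) ^ k

theorem momentExponent_nonneg (k : ℕ) : 0 ≤ momentExponent k := by
  unfold momentExponent overlapExponent
  positivity

theorem exp_five_eighths_lt_two : Real.exp (5 / 8) < 2 := by
  refine lt_of_pow_lt_pow_left₀ 8 (by norm_num) ?_
  calc Real.exp (5 / 8) ^ 8 = Real.exp 1 ^ 5 := by
        rw [← Real.exp_nat_mul, ← Real.exp_nat_mul]
        norm_num
    _ < 3 ^ 5 := by
        gcongr
        exact Real.exp_one_lt_d9.trans (by norm_num)
    _ < 2 ^ 8 := by norm_num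

theorem tendsto_sq_mul_momentExponent :
    Tendsto (fun k : ℕ => (k : ℝ) ^ 2 * momentExponent k) atTop (𝓝 0) := by
  have hhalf (m : ℕ) : Tendsto (fun k : ℕ => (k : ℝ) ^ m * (1 / 2) ^ k) atTop (𝓝 0) :=
    tendsto_pow_const_mul_const_pow_of_lt_one m (by norm_num) (by norm_num)
  have hexp : Tendsto (fun k : ℕ => (k : ℝ) ^ 3 * (Real.exp (5 / 8) / 2) ^ k) atTop (𝓝 0) :=
    tendsto_pow_const_mul_const_pow_of_lt_one 3 (by positivity)
      ((div_lt_one two_pos).2 exp_five_eighths_lt_two)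
  have hsum := (((hhalf 3).const_mul 4).add ((hhalf 4).const_mul (5 / 8))).add (hexp.const_mul 2)
  simp only [mul_zero, add_zero] at hsum
  refine hsum.congr fun k => ?_
  unfold momentExponent overlapExponent
  ring

theorem tendsto_sq_mul_exp_momentExponent_sub_one :
    Tendsto (fun k : ℕ => (k : ℝ) ^ 2 * (Real.exp (momentExponent k) - 1)) atTop (𝓝 0) := by
  have hT := tendsto_sq_mul_momentExponent
  refine squeeze_zero' (Eventually.of_forall fun k => mul_nonneg (sq_nonneg _)
    (sub_nonneg.2 (Real.one_le_exp (momentExponent_nonneg k)))) ?_ (by simpa using hT.const_mul 2)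
  filter_upwards [eventually_ge_atTop 1, hT.eventually (eventually_le_nhds zero_lt_one)]
    with k hk hle
  have hk' : (1 : ℝ) ≤ k := by exact_mod_cast hk
  have hnonneg := momentExponent_nonneg k
  have hle_one : |momentExponent k| ≤ 1 := by
    rw [abs_of_nonneg hnonneg]
    exact (le_mul_of_one_le_left hnonneg (one_le_pow₀ hk')).trans hle
  have := Real.abs_exp_sub_one_le hle_one
  rw [abs_of_nonneg hnonneg] at this
  rw [mul_left_comm]
  gcongr
  exact (le_abs_self _).trans this

theorem exp_overlapExponent_mul_pow_le (k : ℕ) :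
    Real.exp (overlapExponent k) *
      (((2 ^ k : ℕ) - 1 + 2 * Real.exp (5 / 8 * k)) / (2 ^ k : ℕ)) ^ k ≤
    Real.exp (momentExponent k) := by
  push_cast
  have hpow : (1 : ℝ) ≤ 2 ^ k := one_le_pow₀ one_le_two
  have hratio : ((2 : ℝ) ^ k - 1 + 2 * Real.exp (5 / 8 * k)) / 2 ^ k ≤
      Real.exp (2 * (Real.exp (5 / 8) / 2) ^ k) := by
    refine le_trans ?_ (Real.add_one_le_exp _)
    rw [div_le_iff₀ (by positivity), mul_comm (5 / 8 : ℝ), Real.exp_nat_mul, div_pow, add_mul,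
      mul_assoc, div_mul_cancel₀ _ (by positivity)]
    linarith
  have : 0 ≤ ((2 : ℝ) ^ k - 1 + 2 * Real.exp (5 / 8 * k)) / 2 ^ k :=
    div_nonneg (by linarith [Real.exp_nonneg (5 / 8 * (k : ℝ))]) (by positivity)
  calc _ ≤ Real.exp (overlapExponent k) * Real.exp (2 * (Real.exp (5 / 8) / 2) ^ k) ^ k := by gcongr
    _ = _ := by
        rw [← Real.exp_nat_mul, ← Real.exp_add, momentExponent]
        ring_nf

end Moment

section Confusion

/-- A bound for the conditional probability that a tuple does not single out a vertex which it
isolates. -/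
noncomputable def confusionBound (k : ℕ) : ℝ :=
  vertexCount k * (coincidenceFactor k * (k + 1) ^ k) / isolationProb (vertexCount k) k

theorem confusionBound_nonneg (hk : 4 ≤ k) : 0 ≤ confusionBound k := by
  have := isolationProb_pos hk
  unfold confusionBound coincidenceFactor
  positivity

theorem sq_mul_confusionBound_le (hk : 4 ≤ k) :
    (k : ℝ) ^ 2 * confusionBound k ≤
      Real.exp ((3 * k + 4) * Real.log (k + 1) + 2 * k + 5 - k ^ 2 / 16) := by
  have hfour : (2 : ℝ) ^ k * 2 ^ k ≤ Real.exp (2 * k) := by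
    rw [← mul_pow, mul_comm (2 : ℝ) k, Real.exp_nat_mul]
    gcongr
    linarith [Real.quadratic_le_exp_of_nonneg (zero_le_two (α := ℝ))]
  have hinv : ((1 / 2 : ℝ) ^ k * Real.exp (-(k ^ 2 / 2) - 1))⁻¹ =
      2 ^ k * Real.exp (k ^ 2 / 2 + 1) := by
    rw [mul_inv, ← Real.exp_neg, one_div, inv_pow, inv_inv]
    ring_nf
  unfold confusionBound coincidenceFactor
  calc _ ≤ (k : ℝ) ^ 2 * (vertexCount k * (k ^ (2 * k) * Real.exp (4 - 9 / 16 * k ^ 2) *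
        (k + 1) ^ k) / ((1 / 2) ^ k * Real.exp (-(k ^ 2 / 2) - 1))) := by
        gcongr
        exact half_pow_mul_exp_le_isolationProb hk
    _ = (k : ℝ) ^ 2 * (k ^ 2 / 2) * (k ^ (2 * k) * (k + 1) ^ k) * (2 ^ k * 2 ^ k) *
        (Real.exp (4 - 9 / 16 * k ^ 2) * Real.exp (k ^ 2 / 2 + 1)) := by
      rw [div_eq_mul_inv, hinv, vertexCount_eq (by lia)]
      ring
    _ ≤ ((k : ℝ) + 1) ^ 2 * (k + 1) ^ 2 * ((k + 1) ^ (2 * k) * (k + 1) ^ k) * Real.exp (2 * k) *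
        (Real.exp (4 - 9 / 16 * k ^ 2) * Real.exp (k ^ 2 / 2 + 1)) := by
      gcongr
      · linarith
      · linarith [sq_nonneg (k : ℝ), Nat.cast_nonneg (α := ℝ) k]
      · linarith
    _ = Real.exp ((3 * k + 4 : ℕ) * Real.log (k + 1)) * Real.exp (2 * k) *
        Real.exp (4 - 9 / 16 * k ^ 2 + (k ^ 2 / 2 + 1)) := by
      rw [Real.exp_nat_mul, Real.exp_log (by positivity), Real.exp_add (4 - _)]
      ring
    _ = _ := by
      rw [← Real.exp_add, ← Real.exp_add]
      push_cast
      ring_nf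

theorem tendsto_sq_mul_confusionBound :
    Tendsto (fun k : ℕ => (k : ℝ) ^ 2 * confusionBound k) atTop (𝓝 0) := by
  refine squeeze_zero' ?_ ?_ tendsto_exp_neg_nat
  · filter_upwards [eventually_ge_atTop 4] with k hk
      using mul_nonneg (sq_nonneg _) (confusionBound_nonneg hk)
  filter_upwards [eventually_ge_atTop 1000, eventually_log_le (by norm_num : (0 : ℝ) < 1 / 1000)]
    with k hk hlog
  have hk' : (1000 : ℝ) ≤ k := by exact_mod_cast hk
  refine (sq_mul_confusionBound_le (by lia)).trans (Real.exp_le_exp.2 ?_)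
  have : (3 * (k : ℝ) + 4) * Real.log (k + 1) ≤ (3 * k + 4) * (1 / 1000 * (k + 1)) := by gcongr
  nlinarith

end Confusion

section Unpinned

theorem mul_two_pow_lt_vertexCount (hk : 4 ≤ k) : k * 2 ^ k < vertexCount k := by
  have hpow : 2 ^ k = 2 * 2 ^ (k - 1) := (mul_pow_sub_one (by lia) 2).symm
  have hpos : 0 < k * 2 ^ (k - 1) := Nat.mul_pos (by lia) (Nat.two_pow_pos _)
  calc k * 2 ^ k < k * 2 ^ (k - 1) * 4 := by rw [hpow]; linarith
    _ ≤ k * 2 ^ (k - 1) * k := Nat.mul_le_mul_left _ hk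
    _ = _ := by rw [vertexCount]; ring

theorem exists_embedding_notMem_range (hk : 4 ≤ k) (w : Fin (vertexCount k)) :
    ∃ ι : Fin k × Fin (2 ^ k) ↪ Fin (vertexCount k), w ∉ Set.range ι := by
  have hcard : Fintype.card (Fin k × Fin (2 ^ k)) ≤ Fintype.card {v // v ≠ w} := by
    simpa using Nat.le_sub_one_of_lt (mul_two_pow_lt_vertexCount hk)
  obtain ⟨ι⟩ := Function.Embedding.nonempty_of_card_le hcard
  exact ⟨ι.trans (Function.Embedding.subtype _), fun ⟨p, hp⟩ => (ι p).2 hp⟩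

theorem expect_ind_not_isPinned_vertexCount_le (hk : 4 ≤ k) (w : Fin (vertexCount k)) :
    𝔼 f, ind (¬ IsPinned k (graphOf f) w) ≤
      4 * (Real.exp (momentExponent k) - 1) + 2 * confusionBound k := by
  obtain ⟨ι, hw⟩ := exists_embedding_notMem_range hk w
  have hV := Fintype.card_fin (vertexCount k)
  have h := expect_ind_not_isPinned_le (A := Real.exp (overlapExponent k))
    (B := 2 * Real.exp (5 / 8 * k)) (c := vertexCount k * (coincidenceFactor k * (k + 1) ^ k))
    (Nat.two_pow_pos k) hw (by rw [hV]; exact isolationProb_pos hk)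
    (fun s hs => by rw [hV]; exact half_pow_mul_pow_le_isolationProb_sq_mul hk hs)
    (fun X => ?_)
  · rw [hV] at h
    refine h.trans ?_
    rw [confusionBound]
    gcongr
    exact exp_overlapExponent_mul_pow_le k
  · have hX := expect_ind_isolates_and_isConfused_le X w (h := coincidenceFactor k)
      (by unfold coincidenceFactor; positivity)
      (fun j hj hjk => by rw [hV]; exact half_pow_mul_pow_le_coincidenceFactor_mul hk hj hjk)
    rwa [hV] at hX

/-- The probability that at least `2 ^ (k - 3)` vertices are not pinned. -/
noncomputable def unpinnedError (k : ℕ) : ℝ :=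
  𝔼 f : Sym2 (Fin (vertexCount k)) → Bool,
    ind ((2 : ℝ) ^ (k - 3) ≤ ∑ w, ind (¬ IsPinned k (graphOf f) w))

theorem unpinnedError_le (hk : 4 ≤ k) :
    unpinnedError k ≤
      4 * (k ^ 2 * (4 * (Real.exp (momentExponent k) - 1) + 2 * confusionBound k)) := by
  have hn : (vertexCount k : ℝ) = 4 * k ^ 2 * 2 ^ (k - 3) := by
    rw [vertexCount, show k - 1 = k - 3 + 2 by lia, pow_add]
    push_cast
    ring
  refine (expect_ind_le_of_markov (fun f => Finset.sum_nonneg fun w _ => ind_nonneg _)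
    (by positivity)).trans ?_
  rw [Finset.expect_sum_comm, div_le_iff₀ (by positivity)]
  refine (Finset.sum_le_sum fun w _ => expect_ind_not_isPinned_vertexCount_le hk w).trans_eq ?_
  rw [Finset.sum_const, Finset.card_univ, Fintype.card_fin, nsmul_eq_mul, hn]
  ring

theorem tendsto_unpinnedError : Tendsto unpinnedError atTop (𝓝 0) := by
  have hbound := ((tendsto_sq_mul_exp_momentExponent_sub_one.const_mul 4).add
    (tendsto_sq_mul_confusionBound.const_mul 2)).const_mul 4
  simp only [mul_zero, add_zero] at hbound
  refine squeeze_zero' (Eventually.of_forall fun k => Finset.expect_nonneg fun f _ => ind_nonneg _)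
    ?_ hbound
  filter_upwards [eventually_ge_atTop 4] with k hk
  exact (unpinnedError_le hk).trans_eq (by ring)

end Unpinned

section Depths

variable {G : SimpleGraph (Fin (vertexCount k))}

/-- The definition depths of a graph on `vertexCount k` vertices lie between `k + 1` and
`k + 4`. -/
def HasDepths (k : ℕ) (G : SimpleGraph (Fin (vertexCount k))) : Prop :=
  ((k + 1 : ℕ) : ℕ∞) ≤ defDepth G ∧ defDepth G ≤ defDepthAlt 2 G ∧
    defDepthAlt 2 G ≤ ((k + 4 : ℕ) : ℕ∞)

theorem HasExtension.le_defDepth_vertexCount (hk : 1 ≤ k) (hext : HasExtension (k - 1) G) :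
    ((k + 1 : ℕ) : ℕ∞) ≤ defDepth G := by
  obtain ⟨l, hkl, H, hH⟩ := exists_hasExtension k
  have hGH : ¬ Nonempty (G ≃g H) := fun ⟨e⟩ =>
    (vertexCount_lt_vertexCount hk hkl).ne (by simpa using Fintype.card_congr e.toEquiv)
  have h := hext.le_defDepth (hH.mono (by lia)) hGH
  rwa [show k - 1 + 2 = k + 1 by lia] at h

theorem hasDepths_of_hasExtension (hk : 4 ≤ k) (hext : HasExtension (k - 1) G)
    (hfew : ∑ w, ind (¬ IsPinned k G w) < 2 ^ (k - 3)) : HasDepths k G := by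
  refine ⟨hext.le_defDepth_vertexCount (by lia), defDepth_le_defDepthAlt 2 G,
    defDepthAlt_le_of_isPinned G fun u v huv => ?_⟩
  rw [show k - 1 = k - 3 + 2 by lia] at hext
  refine hext.exists_isPinned_separating ?_ hfew huv
  rw [Fintype.card_fin]
  have := two_mul_add_two_le_vertexCount hk
  lia

theorem one_sub_prob_hasDepths_le (hk : 4 ≤ k) :
    1 - prob (vertexCount k) (HasDepths k) ≤ extensionError k + unpinnedError k := by
  rw [prob_eq_expect, extensionError, unpinnedError, ← Finset.expect_add_distrib,
    ← Fintype.expect_const (ι := Sym2 (Fin (vertexCount k)) → Bool) (1 : ℝ),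
    ← Finset.expect_sub_distrib]
  simp_rw [← ind_not]
  refine Finset.expect_le_expect fun f _ => (ind_mono fun hdepths => ?_).trans (ind_or_le _ _)
  by_contra! hcon
  exact hdepths (hasDepths_of_hasExtension hk hcon.1 hcon.2)

theorem tendsto_prob_hasDepths :
    Tendsto (fun k => prob (vertexCount k) (HasDepths k)) atTop (𝓝 1) := by
  have hbound : Tendsto (fun k => 1 - (extensionError k + unpinnedError k)) atTop (𝓝 1) := by
    simpa using (tendsto_extensionError.add tendsto_unpinnedError).const_sub 1
  refine tendsto_of_tendsto_of_tendsto_of_le_of_le' hbound tendsto_const_nhds ?_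
    (Eventually.of_forall fun k => prob_le_one _ _)
  filter_upwards [eventually_ge_atTop 4] with k hk
  linarith [one_sub_prob_hasDepths_le hk]

theorem tendsto_prob_of_eventually_hasDepths {P : ∀ k, SimpleGraph (Fin (vertexCount k)) → Prop}
    (h : ∀ᶠ k in atTop, ∀ G, HasDepths k G → P k G) :
    Tendsto (fun k => prob (vertexCount k) (P k)) atTop (𝓝 1) := by
  refine tendsto_of_tendsto_of_tendsto_of_le_of_le' tendsto_prob_hasDepths tendsto_const_nhds ?_
    (Eventually.of_forall fun k => prob_le_one _ _)
  filter_upwards [h] with k hk using prob_mono hk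

end Depths

section MainTerm

theorem log_vertexCount (hk : 1 ≤ k) :
    Real.log (vertexCount k) = (k - 1) * Real.log 2 + 2 * Real.log k := by
  have : (k : ℝ) ≠ 0 := by exact_mod_cast (by lia : k ≠ 0)
  rw [vertexCount, Nat.cast_mul, Nat.cast_pow, Nat.cast_pow, Nat.cast_two,
    Real.log_mul (by positivity) (by positivity), Real.log_pow, Real.log_pow, Nat.cast_sub hk,
    Nat.cast_two, Nat.cast_one, add_comm]

theorem mul_log_two_le_log_vertexCount (hk : 2 ≤ k) :
    k * Real.log 2 ≤ Real.log (vertexCount k) := by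
  have hlog : Real.log 2 ≤ Real.log k := Real.log_le_log two_pos (by exact_mod_cast hk)
  rw [log_vertexCount (by lia)]
  linarith [Real.log_pos one_lt_two]

theorem log_vertexCount_pos (hk : 2 ≤ k) : 0 < Real.log (vertexCount k) :=
  lt_of_lt_of_le (by positivity) (mul_log_two_le_log_vertexCount hk)

theorem mainTerm_vertexCount (hk : 2 ≤ k) :
    mainTerm (vertexCount k) =
      k + Real.logb 2 (k ^ 2 / 2 * Real.log 2 / Real.log (vertexCount k) ^ 2) := by
  have : (0 : ℝ) < k := by exact_mod_cast (by lia : 0 < k)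
  have hlog2 : 0 < Real.log 2 := Real.log_pos one_lt_two
  have hlogn := log_vertexCount_pos hk
  rw [mainTerm, Real.logb_div (by positivity) (by positivity), Real.logb_mul (by positivity)
    hlog2.ne', Real.logb_pow]
  nth_rw 1 [vertexCount_eq (by lia)]
  rw [Real.logb_mul (by positivity) (by positivity), Real.logb_pow, Real.logb_self_eq_one
    one_lt_two]
  push_cast
  ring

theorem mainTerm_vertexCount_le (hk : 2 ≤ k) : mainTerm (vertexCount k) ≤ k := by
  have : Real.logb 2 (k ^ 2 / 2 * Real.log 2 / Real.log (vertexCount k) ^ 2) ≤ 0 := by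
    refine Real.logb_nonpos one_lt_two (by positivity) (div_le_one_of_le₀ ?_ (by positivity))
    calc (k : ℝ) ^ 2 / 2 * Real.log 2 ≤ (k * Real.log 2) ^ 2 := by
          nlinarith [Real.log_two_gt_d9, sq_nonneg (k : ℝ)]
      _ ≤ _ := by gcongr; exact mul_log_two_le_log_vertexCount hk
  linarith [mainTerm_vertexCount hk]

theorem eventually_log_vertexCount_le : ∀ᶠ k : ℕ in atTop, Real.log (vertexCount k) ≤ k := by
  filter_upwards [eventually_ge_atTop 10, eventually_log_le (by norm_num : (0 : ℝ) < 1 / 10)]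
    with k hk hlog
  have hk' : (10 : ℝ) ≤ k := by exact_mod_cast hk
  have hlogk : Real.log k ≤ Real.log (k + 1) := Real.log_le_log (by positivity) (by linarith)
  rw [log_vertexCount (by lia)]
  nlinarith [Real.log_two_lt_d9]

theorem eventually_le_mainTerm_vertexCount :
    ∀ᶠ k : ℕ in atTop, (k : ℝ) - 2 ≤ mainTerm (vertexCount k) := by
  filter_upwards [eventually_ge_atTop 2, eventually_log_vertexCount_le] with k hk hlogn
  have : (0 : ℝ) < k := by exact_mod_cast (by lia : 0 < k)
  have hlogn₀ := log_vertexCount_pos hk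
  have hrpow : (2 : ℝ) ^ (-2 : ℝ) = 1 / 4 := by
    rw [Real.rpow_neg zero_le_two]
    norm_num
  have : (-2 : ℝ) ≤ Real.logb 2 (k ^ 2 / 2 * Real.log 2 / Real.log (vertexCount k) ^ 2) := by
    rw [Real.le_logb_iff_rpow_le one_lt_two (by positivity), le_div_iff₀ (by positivity), hrpow]
    calc 1 / 4 * Real.log (vertexCount k) ^ 2 ≤ 1 / 4 * (k : ℝ) ^ 2 := by gcongr
      _ ≤ _ := by nlinarith [Real.log_two_gt_d9, sq_nonneg (k : ℝ)]
  linarith [mainTerm_vertexCount hk]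

end MainTerm

end Asymptotics

section Theorem

open Filter Topology

theorem tendsto_prob_defDepthAlt_le :
    Tendsto (fun k => prob (vertexCount k) fun G =>
      ∃ d : ℕ, defDepthAlt 2 G = d ∧ (d : ℝ) ≤ mainTerm (vertexCount k) + 6) atTop (𝓝 1) := by
  refine tendsto_prob_of_eventually_hasDepths ?_
  filter_upwards [eventually_le_mainTerm_vertexCount] with k hk G ⟨_, _, hle⟩
  obtain ⟨d, hd, hdk⟩ := ENat.le_natCast_iff.1 hle
  refine ⟨d, hd, ?_⟩
  rify at hdk
  linarith

theorem tendsto_prob_le_defDepth :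
    Tendsto (fun k => prob (vertexCount k) fun G =>
      ∃ d : ℕ, defDepth G = d ∧ mainTerm (vertexCount k) + 1 ≤ (d : ℝ)) atTop (𝓝 1) := by
  refine tendsto_prob_of_eventually_hasDepths ?_
  filter_upwards [eventually_ge_atTop 2] with k hk G ⟨hge, hle, hle'⟩
  obtain ⟨d, hd, -⟩ := ENat.le_natCast_iff.1 (hle.trans hle')
  refine ⟨d, hd, ?_⟩
  rw [hd, Nat.cast_le] at hge
  rify at hge
  linarith [mainTerm_vertexCount_le hk]

theorem tendsto_prob_defDepth_mem_window :
    Tendsto (fun k => prob (vertexCount k) fun G =>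
      (((k + 1 : ℕ) : ℕ∞) ≤ defDepth G ∧ defDepth G ≤ (k + 1 + 4 : ℕ)) ∧
        (((k + 1 : ℕ) : ℕ∞) ≤ defDepthAlt 2 G ∧ defDepthAlt 2 G ≤ (k + 1 + 4 : ℕ)))
      atTop (𝓝 1) := by
  refine tendsto_prob_of_eventually_hasDepths (Eventually.of_forall fun k G ⟨hge, hle, hle'⟩ => ?_)
  have hup : defDepthAlt 2 G ≤ (k + 1 + 4 : ℕ) := hle'.trans (Nat.cast_le.2 (by lia))
  exact ⟨⟨hge, hle.trans hup⟩, hge.trans hle, hup⟩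

end Theorem

end FirstOrderComplexity

open FirstOrderComplexity in
theorem mainTheorem3 :
    ∃ n : ℕ → ℕ, StrictMono n ∧
      -- the `o(1)` terms
      ∃ ε : ℕ → ℝ, Filter.Tendsto ε Filter.atTop (nhds 0) ∧
      -- the upper bound on `D_2`, with high probability
      Filter.Tendsto (fun j => prob (n j) fun G =>
          ∃ d : ℕ, defDepthAlt 2 G = d ∧ (d : ℝ) ≤ mainTerm (n j) + 6 + ε j)
        Filter.atTop (nhds 1) ∧
      -- the lower bound on `D`, with high probability
      Filter.Tendsto (fun j => prob (n j) fun G =>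
          ∃ d : ℕ, defDepth G = d ∧ mainTerm (n j) + 1 - ε j ≤ (d : ℝ))
        Filter.atTop (nhds 1) ∧
      -- concentration of `D` and `D_2` on five consecutive values
      ∃ a : ℕ → ℕ,
        Filter.Tendsto (fun j => prob (n j) fun G =>
            ((a j : ℕ∞) ≤ defDepth G ∧ defDepth G ≤ (a j + 4 : ℕ)) ∧
            ((a j : ℕ∞) ≤ defDepthAlt 2 G ∧ defDepthAlt 2 G ≤ (a j + 4 : ℕ)))
          Filter.atTop (nhds 1) := by
  refine ⟨fun j => vertexCount (j + 1),
    strictMono_nat_of_lt_succ fun j => vertexCount_lt_vertexCount (by lia) (by lia), fun _ => 0,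
    tendsto_const_nhds, ?_, ?_, fun j => j + 1 + 1, ?_⟩
  · simp only [add_zero]
    exact tendsto_prob_defDepthAlt_le.comp (Filter.tendsto_add_atTop_nat 1)
  · simp only [sub_zero]
    exact tendsto_prob_le_defDepth.comp (Filter.tendsto_add_atTop_nat 1)
  · exact tendsto_prob_defDepth_mem_window.comp (Filter.tendsto_add_atTop_nat 1)
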